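/- Let $n\ge 1$ and let $\mathbf{G}=\{G_1,\dots,G_{2n-1}\}$ be a collection of $2n-1$ (not necessarily distinct) finite simple bipartite graphs on the same vertex set $V$ with the same bipartition $V=X\sqcup Y$, $|X|=|Y|=n$. Suppose that $\delta(G_i)\ge\left\lceil\frac{n+1}{2}\right\rceil$ for each $i\in[2n-1]$. Then at least one of the following statements holds. (i) $\mathbf{G}$ is Hamiltonian connected: for any $x\in X$ and $y\in Y$ there is a path $P$ between $x$ and $y$ with $V(P)=V$ (so $|E(P)|=2n-1$) and an injection $\phi:E(P)\to[2n-1]$ such that $e\in E(G_{\phi(e)})$ for every $e\in E(P)$. (ii) $n$ is odd, and there are partitions $X=\{x^*\}\sqcup X_1\sqcup X_2$ and $Y=\{y^*\}\sqcup Y_1\sqcup Y_2$ with $|X_1|=|X_2|=|Y_1|=|Y_2|=\frac{n-1}{2}$ such that $G_i\in\{F,F'\}$ for each $i\in[2n-1]$. Here $F$ is the graph on $V$ whose edges are all edges between $x^*$ and $Y_1\cup Y_2$, all edges between $y^*$ and $X_1\cup X_2$, and all edges between $X_j$ and $Y_j$ for $j=1,2$, and $F'$ is obtained from $F$ by adding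 the edge $x^*y^*$. (The partitions are the same for all $i$.) -/

import Mathlib

namespace BipartiteTransversal

/-- A graph `H` (with `V(H) ⊆ V`, so a subgraph of the complete graph on `V`) is a `G`-transversal
of the collection `G` of graphs on `V` if it has exactly as many edges as there are graphs in the
collection, and there is an injection `φ` from `E(H)` to the index set such that every edge `e`
of `H` is an edge of `G (φ e)`. -/
def IsTransversal {V ι : Type*} (G : ι → SimpleGraph V) (H : (⊤ : SimpleGraph V).Subgraph) : Prop :=
  Nat.card H.edgeSet = Nat.card ι ∧
    ∃ φ : H.edgeSet → ι, Function.Injective φ ∧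
      ∀ e : H.edgeSet, (e : Sym2 V) ∈ (G (φ e)).edgeSet

/-- There is a `G`-transversal that is a Hamiltonian path between `x` and `y`. -/
def HasHamiltonianPathTransversal {V ι : Type*} [DecidableEq V]
    (G : ι → SimpleGraph V) (x y : V) : Prop :=
  ∃ p : (⊤ : SimpleGraph V).Walk x y, p.IsHamiltonian ∧ IsTransversal G p.toSubgraph

/-- A collection of bipartite graphs on the same bipartition `(X, Y)` is Hamiltonian connected
if for all `x ∈ X` and `y ∈ Y` it has a transversal Hamiltonian path between `x` and `y`. -/
def HamiltonianConnected {V ι : Type*} [DecidableEq V]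
    (X Y : Finset V) (G : ι → SimpleGraph V) : Prop :=
  ∀ x ∈ X, ∀ y ∈ Y, HasHamiltonianPathTransversal G x y

/-- `S = {s} ∪ S₁ ∪ S₂` is a disjoint union with `|S₁| = |S₂| = m`. -/
structure IsSplit {V : Type*} [DecidableEq V]
    (S : Finset V) (s : V) (S₁ S₂ : Finset V) (m : ℕ) : Prop where
  union_eq : S = {s} ∪ S₁ ∪ S₂
  notMem_left : s ∉ S₁
  notMem_right : s ∉ S₂
  disjoint : Disjoint S₁ S₂
  card_left : S₁.card = m
  card_right : S₂.card = m

/-- The graph `F` with parts `{x} ∪ X₁ ∪ X₂` and `{y} ∪ Y₁ ∪ Y₂`: its edges are all edges between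
`x` and `Y₁ ∪ Y₂`, between `y` and `X₁ ∪ X₂`, and between `Xᵢ` and `Yᵢ` for `i = 1, 2`. -/
def graphF {V : Type*} (x y : V) (X₁ X₂ Y₁ Y₂ : Finset V) : SimpleGraph V :=
  SimpleGraph.fromRel fun u v =>
    (u = x ∧ (v ∈ Y₁ ∨ v ∈ Y₂)) ∨ ((u ∈ X₁ ∨ u ∈ X₂) ∧ v = y) ∨
      (u ∈ X₁ ∧ v ∈ Y₁) ∨ (u ∈ X₂ ∧ v ∈ Y₂)

/-- The graph `F'`: the graph `F` with the edge `xy` added. -/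
def graphF' {V : Type*} (x y : V) (X₁ X₂ Y₁ Y₂ : Finset V) : SimpleGraph V :=
  graphF x y X₁ X₂ Y₁ Y₂ ⊔ SimpleGraph.edge x y

end BipartiteTransversal

namespace BipartiteTransversal

/-! Put `n = N + 1` and let `h + 1` be the degree bound, so that `N ≤ 2 * h`. Fix `s ∈ X` and `t ∈
Y` and take a longest rainbow path among those avoiding `s` and `t`. Its endpoints send no edge of
an unused colour to a vertex outside the path other than `s` and `t`.

An odd number of vertices is impossible: a rotation of the path would pick up one more vertex
(`not_odd`). With `2 * l < 2 * N` vertices, edges of two unused colours at the two ends cross, so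
the path closes into a rainbow cycle on the same vertices. No unused colour leaves this cycle except
towards `s` and `t`, and degrees then force `l = h` and `N = 2 * h`. The unused colours are complete
on the cycle and numerous enough to recolour it, so every colour can be made unused. Hence no colour
leaves the cycle, and each graph is `F` or `F'` (`exists_split_of_closed`).

With `2 * N` vertices, the path either extends directly to `s` and `t`, or closes into a rainbow
cycle on all other vertices with one spare colour. A double count of chords coloured like the cycle
edges they replace finds a vertex with many of them. Such chords allow enough reroutings that the
neighbourhoods of `s` and `t` cannot avoid all of them (`hasPath_of_chords`). -/

/-- `ColoredWalk G a b S C`: there is a walk from `a` to `b` with multiset of vertices `S` whose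
edges can be coloured so that an edge of colour `i` belongs to `G i` and `C` is the multiset of
colours. -/
inductive ColoredWalk {V ι : Type*} (G : ι → SimpleGraph V) :
    V → V → Multiset V → Multiset ι → Prop
  | single (a : V) : ColoredWalk G a a {a} 0
  | cons {a b c : V} {S : Multiset V} {C : Multiset ι} {i : ι} :
      (G i).Adj a b → ColoredWalk G b c S C → ColoredWalk G a c (a ::ₘ S) (i ::ₘ C)

/-- The multiset of the values `f a, f (a + 1), …, f (b - 1)`. -/
def seg {α : Type*} (f : ℕ → α) (a b : ℕ) : Multiset α := (Multiset.Ico a b).map f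

/-! ### Stretches of a sequence as multisets -/

section Seg

variable {α : Type*} (f : ℕ → α)

theorem seg_add {a b c : ℕ} (hab : a ≤ b) (hbc : b ≤ c) : seg f a b + seg f b c = seg f a c := by
  rw [seg, seg, seg, ← Multiset.map_add, Multiset.Ico_add_Ico_eq_Ico hab hbc]

theorem seg_self (a : ℕ) : seg f a a = 0 := by simp [seg]

theorem seg_succ_self (a : ℕ) : seg f a (a + 1) = {f a} := by
  simp [seg, Multiset.Ico, Nat.Ico_succ_singleton]

theorem mem_seg {f : ℕ → α} {a b : ℕ} {x : α} : x ∈ seg f a b ↔ ∃ i, a ≤ i ∧ i < b ∧ f i = x := by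
  simp [seg, Multiset.mem_map, and_assoc]

theorem card_seg (a b : ℕ) : (seg f a b).card = b - a := by
  simp [seg, Multiset.Ico]

theorem seg_shift (j a b : ℕ) : seg (fun i => f (i + j)) a b = seg f (a + j) (b + j) := by
  simp only [seg]
  rw [← Multiset.map_add_right_Ico, Multiset.map_map]
  rfl

theorem seg_zero_succ (k : ℕ) : seg f 0 (k + 1) = f 0 ::ₘ seg (fun i => f (i + 1)) 0 k := by
  rw [seg_shift, zero_add, ← seg_add f (Nat.zero_le 1) (by omega), ← Multiset.singleton_add]
  congr 1

theorem seg_injOn {f : ℕ → α} {a b : ℕ} (h : (seg f a b).Nodup) {i j : ℕ} (hi : a ≤ i) (hi' : i < b)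
    (hj : a ≤ j) (hj' : j < b) (hij : f i = f j) : i = j :=
  Multiset.inj_on_of_nodup_map h i (by simp [hi, hi']) j (by simp [hj, hj']) hij

theorem seg_periodic {f : ℕ → α} {K : ℕ} (h : ∀ i, f (i + K) = f i) (j : ℕ) :
    seg f j (j + K) = seg f 0 K := by
  induction j with
  | zero => simp
  | succ j ih =>
    rw [← ih]
    have h1 := seg_add f (Nat.le_succ j) (show j + 1 ≤ j + 1 + K by omega)
    have h2 := seg_add f (show j ≤ j + K by omega) (show j + K ≤ j + 1 + K by omega)
    have h3 : j + 1 + K = j + K + 1 := by omega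
    rw [← h1, h3, seg_succ_self, seg_succ_self, h, add_comm] at h2
    rw [h3]
    exact (add_left_cancel h2).symm

end Seg

/-! ### Rainbow walks and transversal Hamiltonian paths -/

section Walks

variable {V ι : Type*} {G : ι → SimpleGraph V}

namespace ColoredWalk

/-- Multisets forget order, so reversing a walk costs nothing, and a rerouting is checked by
splitting segments at the cuts and applying `abel`. -/
theorem join {a b c d : V} {S T : Multiset V} {C D : Multiset ι} {i : ι}
    (h : ColoredWalk G a b S C) (hi : (G i).Adj b c) (h' : ColoredWalk G c d T D) :
    ColoredWalk G a d (S + T) (C + {i} + D) := by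
  induction h with
  | single a =>
    have := cons hi h'
    simpa [Multiset.singleton_add] using this
  | cons hj _ ih =>
    have := cons hj (ih hi)
    simpa [Multiset.cons_add] using this

theorem symm {a b : V} {S : Multiset V} {C : Multiset ι} (h : ColoredWalk G a b S C) :
    ColoredWalk G b a S C := by
  induction h with
  | single a => exact single a
  | @cons a b c S C i hi _ ih =>
    have := ih.join hi.symm (single a)
    rwa [add_zero, add_comm, add_comm C, Multiset.singleton_add, Multiset.singleton_add] at this

theorem card_eq {a b : V} {S : Multiset V} {C : Multiset ι} (h : ColoredWalk G a b S C) :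
    S.card = C.card + 1 := by
  induction h with
  | single a => simp
  | cons _ _ ih => simp [ih]

theorem of_seq (v : ℕ → V) (c : ℕ → ι) {a b : ℕ} (hab : a ≤ b)
    (h : ∀ i, a ≤ i → i < b → (G (c i)).Adj (v i) (v (i + 1))) :
    ColoredWalk G (v a) (v b) (seg v a (b + 1)) (seg c a b) := by
  induction b, hab using Nat.le_induction with
  | base => simpa [seg_succ_self, seg_self] using single (G := G) (v a)
  | succ b hab ih =>
    have := (ih fun i h1 h2 => h i h1 (by omega)).join (h b hab (by omega)) (single _)
    rwa [add_zero, ← seg_succ_self v (b + 1), ← seg_succ_self c b, seg_add _ (by omega) (by omega),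
      seg_add _ (by omega) (by omega)] at this

theorem exists_seq [Nonempty ι] {a b : V} {S : Multiset V} {C : Multiset ι}
    (h : ColoredWalk G a b S C) :
    ∃ (v : ℕ → V) (c : ℕ → ι), v 0 = a ∧ v C.card = b ∧ S = seg v 0 (C.card + 1) ∧
      C = seg c 0 C.card ∧ ∀ i, i < C.card → (G (c i)).Adj (v i) (v (i + 1)) := by
  induction h with
  | single a =>
    exact ⟨fun _ => a, fun _ => Classical.arbitrary ι, rfl, rfl, by simp [seg_succ_self],
      by simp [seg_self], by simp⟩
  | @cons a b d S C i hi _ ih =>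
    obtain ⟨v, c, h0, h1, hS, hC, hadj⟩ := ih
    refine ⟨fun n => n.casesOn a v, fun n => n.casesOn i c, rfl, ?_, ?_, ?_, ?_⟩
    · simpa using h1
    · rw [Multiset.card_cons, seg_zero_succ]
      exact congrArg _ hS
    · rw [Multiset.card_cons, seg_zero_succ]
      exact congrArg _ hC
    · intro j hj
      cases j with
      | zero => simpa [h0] using hi
      | succ j =>
        rw [Multiset.card_cons] at hj
        exact hadj j (by omega)

/-- `C` alone no longer tells which edge has which colour; the list of pairs recovers this, and the
injection is read off it. -/
theorem exists_walk {a b : V} {S : Multiset V} {C : Multiset ι}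
    (hS : S.Nodup) (h : ColoredWalk G a b S C) :
    ∃ (p : (⊤ : SimpleGraph V).Walk a b) (L : List (Sym2 V × ι)), (p.support : Multiset V) = S ∧
      L.map Prod.fst = p.edges ∧ (L.map Prod.snd : Multiset ι) = C ∧
      ∀ q ∈ L, q.1 ∈ (G q.2).edgeSet := by
  induction h with
  | single a => exact ⟨.nil, [], rfl, rfl, rfl, by simp⟩
  | @cons a b d S C i hi _ ih =>
    obtain ⟨p, L, h1, h2, h3, h4⟩ := ih (Multiset.nodup_cons.1 hS).2
    refine ⟨.cons (by simpa using hi.ne) p, (s(a, b), i) :: L, ?_, ?_, ?_, ?_⟩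
    · rw [SimpleGraph.Walk.support_cons, ← h1, Multiset.cons_coe]
    · simp [h2]
    · rw [← h3]; simp
    · simpa using ⟨hi, fun a b hab => h4 _ hab⟩

theorem hasHamiltonianPathTransversal [Fintype ι] [DecidableEq V] {a b : V} {S : Multiset V}
    {C : Multiset ι} (h : ColoredWalk G a b S C) (hS : S.Nodup) (hC : C.Nodup)
    (hS' : ∀ z, z ∈ S) (hC' : ∀ i, i ∈ C) : HasHamiltonianPathTransversal G a b := by
  obtain ⟨p, L, h1, h2, h3, h4⟩ := h.exists_walk hS
  have hsup : p.support.Nodup := by rwa [← h1, Multiset.coe_nodup] at hS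
  have hpath : p.IsPath := ⟨⟨by
    exact SimpleGraph.Walk.edges_nodup_of_support_nodup hsup⟩, hsup⟩
  have hLC : (L.map Prod.snd).Nodup := by rwa [← h3, Multiset.coe_nodup] at hC
  have hedges : p.edges.Nodup := SimpleGraph.Walk.edges_nodup_of_support_nodup hsup
  have hmem : ∀ e ∈ p.toSubgraph.edgeSet, ∃ i, (e, i) ∈ L := by
    intro e he
    rw [SimpleGraph.Walk.mem_edges_toSubgraph, ← h2] at he
    simpa using he
  refine ⟨p, ?_, ?_, fun e => (hmem e e.2).choose, ?_, ?_⟩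
  · intro z
    refine List.count_eq_one_of_mem hsup ?_
    have := hS' z
    rwa [← h1] at this
  · have : p.toSubgraph.edgeSet = (p.edges.toFinset : Set (Sym2 V)) := by
      ext e
      simp
    rw [Nat.card_coe_set_eq, this, Set.ncard_coe_finset, List.toFinset_card_of_nodup hedges, ← h2,
      List.length_map, Nat.card_eq_fintype_card, ← Finset.card_univ]
    have : (Finset.univ : Finset ι).val = C :=
      (Multiset.Nodup.ext Finset.univ.nodup hC).2 fun i => by simp [hC' i]
    rw [Finset.card_def, this, ← h3]
    simp
  · intro e f hef
    have he := (hmem e e.2).choose_spec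
    have hf := (hmem f f.2).choose_spec
    have := List.inj_on_of_nodup_map hLC he hf hef
    exact Subtype.ext (congrArg Prod.fst this)
  · intro e
    exact h4 _ (hmem e e.2).choose_spec

end ColoredWalk

end Walks

/-! ### Dense bipartite families and closed walks -/

section Family

variable {V ι : Type*} [Fintype V] [Fintype ι]

/-- A collection of `2 * N + 1` bipartite graphs with parts `X` and `Y` of size `N + 1` and minimum
degrees at least `h + 1`, where `N ≤ 2 * h`. -/
structure IsDenseFamily (G : ι → SimpleGraph V) (X Y : Finset V) (N h : ℕ) : Prop where
  disj : Disjoint X Y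
  cover : ∀ z, z ∈ X ∨ z ∈ Y
  card_left : X.card = N + 1
  card_right : Y.card = N + 1
  adj_left : ∀ {i a b}, (G i).Adj a b → a ∈ X → b ∈ Y
  adj_right : ∀ {i a b}, (G i).Adj a b → a ∈ Y → b ∈ X
  degree : ∀ i v, h + 1 ≤ ((G i).neighborSet v).ncard
  le : N ≤ 2 * h
  pos : 1 ≤ N
  card_colors : Fintype.card ι = 2 * N + 1

variable {G : ι → SimpleGraph V} {X Y : Finset V} {N h : ℕ}

namespace IsDenseFamily

omit [Fintype V] in
theorem symm (F : IsDenseFamily G X Y N h) : IsDenseFamily G Y X N h :=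
  ⟨F.disj.symm, fun z => (F.cover z).symm, F.card_right, F.card_left, F.adj_right, F.adj_left,
    F.degree, F.le, F.pos, F.card_colors⟩

theorem card_verts (F : IsDenseFamily G X Y N h) : Fintype.card V = 2 * N + 2 := by
  classical
  have : (Finset.univ : Finset V) = X ∪ Y := by
    ext z; simpa using F.cover z
  rw [← Finset.card_univ, this, Finset.card_union_of_disjoint F.disj, F.card_left, F.card_right]
  omega

omit [Fintype V] in
theorem notMem_right (F : IsDenseFamily G X Y N h) {z : V} (hz : z ∈ X) : z ∉ Y :=
  Finset.disjoint_left.1 F.disj hz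

omit [Fintype V] in
-- This turns degrees into counts of indices along a path or cycle. `E` collects possible neighbours
-- off it.
open Classical in
theorem degree_le {α : Type*} (F : IsDenseFamily G X Y N h) (i : ι) (z : V) (E : Finset V)
    (R : Finset α) (f : α → V)
    (hz : ∀ w, (G i).Adj z w → w ∈ E ∨ ∃ r ∈ R, f r = w) :
    h + 1 ≤ E.card + (R.filter fun r => (G i).Adj z (f r)).card := by
  refine (F.degree i z).trans ?_
  have : (G i).neighborSet z ⊆
      ((E ∪ (R.filter fun r => (G i).Adj z (f r)).image f : Finset V) : Set V) := by
    intro w hw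
    rcases hz w hw with h1 | ⟨r, hr, rfl⟩
    · simp [h1]
    · simp only [Finset.coe_union, Finset.coe_image, Set.mem_union, Set.mem_image, Finset.mem_coe,
        Finset.mem_filter]
      exact Or.inr ⟨r, ⟨hr, hw⟩, rfl⟩
  refine (Set.ncard_le_ncard this (Finset.finite_toSet _)).trans ?_
  rw [Set.ncard_coe_finset]
  exact (Finset.card_union_le _ _).trans (Nat.add_le_add_left Finset.card_image_le _)

omit [Fintype V] in
theorem parity (F : IsDenseFamily G X Y N h) {v : ℕ → V} {c : ℕ → ι} {k : ℕ}
    (hadj : ∀ i < k, (G (c i)).Adj (v i) (v (i + 1))) (h0 : v 0 ∈ X) (i : ℕ) :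
    (2 * i ≤ k → v (2 * i) ∈ X) ∧ (2 * i + 1 ≤ k → v (2 * i + 1) ∈ Y) := by
  have key : 2 * i ≤ k → v (2 * i) ∈ X := by
    induction i with
    | zero => exact fun _ => h0
    | succ i ih =>
      intro hi
      exact F.adj_right (hadj (2 * i + 1) (by omega))
        (F.adj_left (hadj (2 * i) (by omega)) (ih (by omega)))
  exact ⟨key, fun hi => F.adj_left (hadj (2 * i) (by omega)) (key (by omega))⟩

theorem hasPath [DecidableEq V] (F : IsDenseFamily G X Y N h) {s t : V} {S : Multiset V}
    {C : Multiset ι} (hw : ColoredWalk G s t S C) (hS : S.Nodup) (hC : C.Nodup)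
    (hcard : S.card = 2 * N + 2) : HasHamiltonianPathTransversal G s t := by
  classical
  have hC' : C.card = 2 * N + 1 := by have := hw.card_eq; omega
  refine hw.hasHamiltonianPathTransversal hS hC (fun z => ?_) (fun i => ?_)
  · have : S.toFinset = Finset.univ := by
      apply Finset.eq_univ_of_card
      rw [Multiset.toFinset_card_of_nodup hS, hcard, F.card_verts]
    simpa using this.ge (Finset.mem_univ z)
  · have : C.toFinset = Finset.univ := by
      apply Finset.eq_univ_of_card
      rw [Multiset.toFinset_card_of_nodup hC, hC', F.card_colors]
    simpa using this.ge (Finset.mem_univ i)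

theorem mem_of_card (F : IsDenseFamily G X Y N h) {s t : V} {S : Multiset V} (hS : S.Nodup)
    (hs : s ∉ S) (ht : t ∉ S) (hst : s ≠ t) (hcard : S.card = 2 * N) (z : V) :
    z = s ∨ z = t ∨ z ∈ S := by
  classical
  have : (s ::ₘ t ::ₘ S).toFinset = Finset.univ := by
    apply Finset.eq_univ_of_card
    rw [Multiset.toFinset_card_of_nodup, F.card_verts]
    · simp [hcard]
    · simp [hst, hs, ht, hS]
  simpa using this.ge (Finset.mem_univ z)

omit [Fintype V] in
theorem exists_color (F : IsDenseFamily G X Y N h) {C : Multiset ι} (hC : C.card ≤ 2 * N) :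
    ∃ i, i ∉ C := by
  classical
  by_contra! hcon
  have : C.toFinset = Finset.univ := by ext i; simp [hcon i]
  have h1 := Multiset.toFinset_card_le C
  rw [this, Finset.card_univ, F.card_colors] at h1
  omega

omit [Fintype V] in
theorem exists_two_colors (F : IsDenseFamily G X Y N h) {C : Multiset ι}
    (hC : C.card + 1 ≤ 2 * N) : ∃ i j, i ∉ C ∧ j ∉ C ∧ i ≠ j := by
  obtain ⟨i, hi⟩ := F.exists_color (C := C) (by omega)
  obtain ⟨j, hj⟩ := F.exists_color (C := i ::ₘ C) (by simpa using hC)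
  rw [Multiset.mem_cons, not_or] at hj
  exact ⟨i, j, hi, hj.2, fun hij => hj.1 hij.symm⟩

end IsDenseFamily

/-- A closed walk with `K` edges, given by the periodic sequence `v` of its vertices and the
periodic sequence `c` of the colours of its edges. -/
structure IsClosedSeq (G : ι → SimpleGraph V) (v : ℕ → V) (c : ℕ → ι) (K : ℕ) : Prop where
  adj : ∀ i, (G (c i)).Adj (v i) (v (i + 1))
  period_vert : ∀ i, v (i + K) = v i
  period_color : ∀ i, c (i + K) = c i

omit [Fintype V] [Fintype ι] in
theorem IsClosedSeq.shift {v : ℕ → V} {c : ℕ → ι} {K : ℕ} (H : IsClosedSeq G v c K) (j : ℕ) :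
    IsClosedSeq G (fun i => v (i + j)) (fun i => c (i + j)) K :=
  ⟨fun i => by have := H.adj (i + j); rwa [show i + j + 1 = i + 1 + j by omega] at this,
    fun i => by rw [show i + K + j = i + j + K by omega, H.period_vert],
    fun i => by rw [show i + K + j = i + j + K by omega, H.period_color]⟩

end Family

/-! ### From a rainbow cycle missing only `s` and `t` to a path between them -/

section SpanningCycle

variable {V ι : Type*} [Fintype V] [Fintype ι]

/-- A rainbow closed walk through all vertices but `s` and `t`, with a colour `β` left over. -/
structure IsSpanningCycle (G : ι → SimpleGraph V) (X Y : Finset V) (N : ℕ) (s t : V) (v : ℕ → V)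
    (c : ℕ → ι) (β : ι) : Prop where
  closed : IsClosedSeq G v c (2 * N)
  vert_nodup : (seg v 0 (2 * N)).Nodup
  color_nodup : (seg c 0 (2 * N)).Nodup
  left_mem : s ∈ X
  right_mem : t ∈ Y
  left_notMem : s ∉ seg v 0 (2 * N)
  right_notMem : t ∉ seg v 0 (2 * N)
  zero_mem : v 0 ∈ X
  color_notMem : β ∉ seg c 0 (2 * N)

variable {G : ι → SimpleGraph V} {X Y : Finset V} {N h : ℕ} {s t : V} {v : ℕ → V} {c : ℕ → ι}
  {β : ι}

namespace IsSpanningCycle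

omit [Fintype V] in
theorem even_mem (H : IsSpanningCycle G X Y N s t v c β) (F : IsDenseFamily G X Y N h) (i : ℕ) :
    v (2 * i) ∈ X :=
  (F.parity (k := 2 * i) (fun i _ => H.closed.adj i) H.zero_mem i).1 le_rfl

omit [Fintype V] in
theorem odd_mem (H : IsSpanningCycle G X Y N s t v c β) (F : IsDenseFamily G X Y N h) (i : ℕ) :
    v (2 * i + 1) ∈ Y :=
  (F.parity (k := 2 * i + 1) (fun i _ => H.closed.adj i) H.zero_mem i).2 le_rfl

omit [Fintype V] in
theorem shift (H : IsSpanningCycle G X Y N s t v c β) (F : IsDenseFamily G X Y N h) (j : ℕ) :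
    IsSpanningCycle G X Y N s t (fun i => v (i + 2 * j)) (fun i => c (i + 2 * j)) β := by
  have hv : seg (fun i => v (i + 2 * j)) 0 (2 * N) = seg v 0 (2 * N) := by
    rw [seg_shift, zero_add, add_comm (2 * N), seg_periodic H.closed.period_vert]
  have hc : seg (fun i => c (i + 2 * j)) 0 (2 * N) = seg c 0 (2 * N) := by
    rw [seg_shift, zero_add, add_comm (2 * N), seg_periodic H.closed.period_color]
  refine ⟨H.closed.shift _, ?_, ?_, H.left_mem, H.right_mem, ?_, ?_, ?_, ?_⟩
  · rw [hv]; exact H.vert_nodup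
  · rw [hc]; exact H.color_nodup
  · rw [hv]; exact H.left_notMem
  · rw [hv]; exact H.right_notMem
  · simpa using H.even_mem F j
  · rw [hc]; exact H.color_notMem

omit [Fintype V] in
theorem ne (H : IsSpanningCycle G X Y N s t v c β) (F : IsDenseFamily G X Y N h) : s ≠ t := by
  rintro rfl
  exact F.notMem_right H.left_mem H.right_mem

theorem exists_eq (H : IsSpanningCycle G X Y N s t v c β) (F : IsDenseFamily G X Y N h) (z : V) :
    z = s ∨ z = t ∨ ∃ i, i < 2 * N ∧ v i = z := by
  simpa [mem_seg] using F.mem_of_card H.vert_nodup H.left_notMem H.right_notMem (H.ne F)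
    (by simp [card_seg]) z

theorem exists_odd (H : IsSpanningCycle G X Y N s t v c β) (F : IsDenseFamily G X Y N h) {z : V}
    (hz : z ∈ Y) : z = t ∨ ∃ r ∈ Finset.range N, v (2 * r + 1) = z := by
  rcases H.exists_eq F z with rfl | rfl | ⟨i, hi, rfl⟩
  · exact absurd hz (F.notMem_right H.left_mem)
  · exact Or.inl rfl
  · obtain ⟨r, rfl | rfl⟩ := Nat.even_or_odd' i
    · exact absurd hz (F.notMem_right (H.even_mem F r))
    · exact Or.inr ⟨r, by rw [Finset.mem_range]; omega, rfl⟩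

theorem exists_even (H : IsSpanningCycle G X Y N s t v c β) (F : IsDenseFamily G X Y N h) {z : V}
    (hz : z ∈ X) : z = s ∨ ∃ r ∈ Finset.range N, v (2 * r) = z := by
  rcases H.exists_eq F z with rfl | rfl | ⟨i, hi, rfl⟩
  · exact Or.inl rfl
  · exact absurd H.right_mem (F.notMem_right hz)
  · obtain ⟨r, rfl | rfl⟩ := Nat.even_or_odd' i
    · exact Or.inr ⟨r, by rw [Finset.mem_range]; omega, rfl⟩
    · exact absurd (H.odd_mem F r) (F.notMem_right hz)

open Classical in
theorem degree_left_le (H : IsSpanningCycle G X Y N s t v c β) (F : IsDenseFamily G X Y N h)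
    (i : ι) {z : V} (hz : z ∈ X) :
    h + 1 ≤ (if (G i).Adj z t then 1 else 0) +
      ((Finset.range N).filter fun r => (G i).Adj z (v (2 * r + 1))).card := by
  refine (F.degree_le i z (if (G i).Adj z t then {t} else ∅) (Finset.range N)
    (fun r => v (2 * r + 1)) fun w hw => ?_).trans (by split_ifs <;> simp)
  rcases H.exists_odd F (F.adj_left hw hz) with rfl | h1
  · simp [hw]
  · exact Or.inr h1

open Classical in
theorem degree_right_le (H : IsSpanningCycle G X Y N s t v c β) (F : IsDenseFamily G X Y N h)
    (i : ι) {z : V} (hz : z ∈ Y) :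
    h + 1 ≤ (if (G i).Adj z s then 1 else 0) +
      ((Finset.range N).filter fun r => (G i).Adj z (v (2 * r))).card := by
  refine (F.degree_le i z (if (G i).Adj z s then {s} else ∅) (Finset.range N)
    (fun r => v (2 * r)) fun w hw => ?_).trans (by split_ifs <;> simp)
  rcases H.exists_even F (F.adj_right hw hz) with rfl | h1
  · simp [hw]
  · exact Or.inr h1

theorem hasPath [DecidableEq V] (H : IsSpanningCycle G X Y N s t v c β)
    (F : IsDenseFamily G X Y N h) {S : Multiset V} {C : Multiset ι} (hw : ColoredWalk G s t S C)
    (hS : S = {s} + {t} + seg v 0 (2 * N)) (hC : C = {β} + seg c 0 (2 * N)) :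
    HasHamiltonianPathTransversal G s t := by
  refine F.hasPath hw ?_ ?_ ?_
  · rw [hS, add_assoc, Multiset.singleton_add, Multiset.singleton_add, Multiset.nodup_cons,
      Multiset.nodup_cons, Multiset.mem_cons, not_or]
    exact ⟨⟨H.ne F, H.left_notMem⟩, H.right_notMem, H.vert_nodup⟩
  · rw [hC, Multiset.singleton_add, Multiset.nodup_cons]
    exact ⟨H.color_notMem, H.color_nodup⟩
  · simp only [hS, Multiset.card_add, Multiset.card_singleton, card_seg]
    omega

omit [Fintype V] [Fintype ι] in
theorem walk (H : IsSpanningCycle G X Y N s t v c β) {a b : ℕ} (hab : a ≤ b) :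
    ColoredWalk G (v a) (v b) (seg v a (b + 1)) (seg c a b) :=
  .of_seq v c hab fun i _ _ => H.closed.adj i

omit [Fintype V] [Fintype ι] in
theorem adj_last (H : IsSpanningCycle G X Y N s t v c β) (hN : 1 ≤ N) :
    (G (c (2 * N - 1))).Adj (v (2 * N - 1)) (v 0) := by
  have := H.closed.adj (2 * N - 1)
  have h0 := H.closed.period_vert 0
  rwa [show 2 * N - 1 + 1 = 0 + 2 * N by omega, h0] at this

theorem seg_last {α : Type*} (f : ℕ → α) {N : ℕ} (hN : 1 ≤ N) :
    seg f (2 * N - 1) (2 * N) = {f (2 * N - 1)} := by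
  rw [← seg_succ_self, show 2 * N - 1 + 1 = 2 * N by omega]

open Classical in
/-- The indices `r` for which `v (2 * r)` is joined to `z` in the colour of the next edge of the
closed walk. -/
noncomputable def chords (G : ι → SimpleGraph V) (v : ℕ → V) (c : ℕ → ι) (N : ℕ) (z : V) :
    Finset ℕ :=
  (Finset.range N).filter fun r => (G (c (2 * r))).Adj (v (2 * r)) z

omit [Fintype V] [Fintype ι] in
open Classical in
theorem card_chords_shift (H : IsSpanningCycle G X Y N s t v c β) (j : ℕ) (z : V) :
    (chords G (fun i => v (i + 2 * j)) (fun i => c (i + 2 * j)) N z).card =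
      (chords G v c N z).card := by
  have hper : Function.Periodic (fun r => (G (c (2 * r))).Adj (v (2 * r)) z) N := by
    intro r
    simp only [mul_add, H.closed.period_vert, H.closed.period_color]
  have h1 := Nat.filter_Ico_card_eq_of_periodic j N _ hper
  have h2 := Nat.filter_Ico_card_eq_of_periodic 0 N _ hper
  rw [zero_add] at h2
  rw [chords, chords, Finset.range_eq_Ico, h2, ← h1, add_comm j N, ← zero_add j, ← add_assoc,
    ← Finset.image_add_right_Ico, Finset.filter_image, zero_add,
    Finset.card_image_of_injective _ (add_left_injective j)]
  simp only [mul_add, add_zero]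

section Paths

variable [DecidableEq V]

/-- Cutting the cycle at `v (2 * r) v (2 * r + 1)` frees the colour of that edge for reaching `t`;
`β` serves `s`. -/
theorem hasPath_of_adj_adj (H : IsSpanningCycle G X Y N s t v c β) (F : IsDenseFamily G X Y N h)
    {r : ℕ} (hr : r < N) (h1 : (G β).Adj s (v (2 * r + 1)))
    (h2 : (G (c (2 * r))).Adj (v (2 * r)) t) : HasHamiltonianPathTransversal G s t := by
  have w := (((ColoredWalk.single s).join h1 (H.walk (show 2 * r + 1 ≤ 2 * N - 1 by omega))).join
    (H.adj_last F.pos) (H.walk (Nat.zero_le (2 * r)))).join h2 (.single t)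
  rw [show 2 * N - 1 + 1 = 2 * N by omega] at w
  refine H.hasPath F w ?_ ?_
  · rw [← seg_add v (Nat.zero_le (2 * r + 1)) (show 2 * r + 1 ≤ 2 * N by omega)]
    abel
  · rw [← seg_add c (Nat.zero_le (2 * r)) (show 2 * r ≤ 2 * N by omega),
      ← seg_add c (show 2 * r ≤ 2 * r + 1 by omega) (show 2 * r + 1 ≤ 2 * N by omega),
      ← seg_add c (show 2 * r + 1 ≤ 2 * N - 1 by omega) (show 2 * N - 1 ≤ 2 * N by omega),
      seg_last c F.pos, seg_succ_self]
    abel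

/-- The path is `s, v (2 * r + 1), …, v (2 * N - 1), v (2 * r), …, v 0, t`: the chord inherits the
colour of the edge it replaces, and the deleted closing edge gives its colour to `t`. -/
theorem hasPath_of_chord_zero (H : IsSpanningCycle G X Y N s t v c β)
    (F : IsDenseFamily G X Y N h) {r : ℕ} (hr : r < N)
    (h1 : (G β).Adj s (v (2 * r + 1)))
    (h2 : (G (c (2 * r))).Adj (v (2 * r)) (v (2 * N - 1)))
    (h3 : (G (c (2 * N - 1))).Adj t (v 0)) : HasHamiltonianPathTransversal G s t := by
  have w := (((ColoredWalk.single s).join h1 (H.walk (show 2 * r + 1 ≤ 2 * N - 1 by omega))).join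
    h2.symm (H.walk (Nat.zero_le (2 * r))).symm).join h3.symm (.single t)
  rw [show 2 * N - 1 + 1 = 2 * N by omega] at w
  refine H.hasPath F w ?_ ?_
  · rw [← seg_add v (Nat.zero_le (2 * r + 1)) (show 2 * r + 1 ≤ 2 * N by omega)]
    abel
  · rw [← seg_add c (Nat.zero_le (2 * r)) (show 2 * r ≤ 2 * N by omega),
      ← seg_add c (show 2 * r ≤ 2 * r + 1 by omega) (show 2 * r + 1 ≤ 2 * N by omega),
      ← seg_add c (show 2 * r + 1 ≤ 2 * N - 1 by omega) (show 2 * N - 1 ≤ 2 * N by omega),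
      seg_last c F.pos, seg_succ_self]
    abel

/-- The chords `h2` and `h4` give a second cycle `v 0, …, v (2 * r), v (2 * N - 1), …, v (2 * r +
1)`. It is cut at `v (2 * j + 1) v (2 * j + 2)`, whose colour `h4` uses, leaving the colour of the
closing edge for `t`. The cases say on which arc the cut lies. -/
theorem hasPath_of_chord_odd (H : IsSpanningCycle G X Y N s t v c β)
    (F : IsDenseFamily G X Y N h) {r j : ℕ} (hr : r < N) (hj : j + 1 < N)
    (h1 : (G β).Adj s (v (2 * j + 1)))
    (h2 : (G (c (2 * r))).Adj (v (2 * r)) (v (2 * N - 1)))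
    (h3 : (G (c (2 * N - 1))).Adj t (v (2 * j + 1 + 1)))
    (h4 : (G (c (2 * j + 1))).Adj (v 0) (v (2 * r + 1))) :
    HasHamiltonianPathTransversal G s t := by
  rcases le_or_gt r j with hrj | hrj
  · have w := ((((ColoredWalk.single s).join h1
      (H.walk (show 2 * r + 1 ≤ 2 * j + 1 by omega)).symm).join
      h4.symm (H.walk (Nat.zero_le (2 * r)))).join h2
      (H.walk (show 2 * j + 1 + 1 ≤ 2 * N - 1 by omega)).symm).join h3.symm (.single t)
    rw [show 2 * N - 1 + 1 = 2 * N by omega] at w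
    refine H.hasPath F w ?_ ?_
    · rw [← seg_add v (Nat.zero_le (2 * r + 1)) (show 2 * r + 1 ≤ 2 * N by omega),
        ← seg_add v (show 2 * r + 1 ≤ 2 * j + 1 + 1 by omega) (show 2 * j + 1 + 1 ≤ 2 * N by omega)]
      abel
    · rw [← seg_add c (Nat.zero_le (2 * r)) (show 2 * r ≤ 2 * N by omega),
        ← seg_add c (show 2 * r ≤ 2 * r + 1 by omega) (show 2 * r + 1 ≤ 2 * N by omega),
        ← seg_add c (show 2 * r + 1 ≤ 2 * j + 1 by omega) (show 2 * j + 1 ≤ 2 * N by omega),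
        ← seg_add c (show 2 * j + 1 ≤ 2 * j + 1 + 1 by omega) (show 2 * j + 1 + 1 ≤ 2 * N by omega),
        ← seg_add c (show 2 * j + 1 + 1 ≤ 2 * N - 1 by omega) (show 2 * N - 1 ≤ 2 * N by omega),
        seg_last c F.pos, seg_succ_self, seg_succ_self]
      abel
  · have w := ((((ColoredWalk.single s).join h1
      (H.walk (Nat.zero_le (2 * j + 1))).symm).join
      h4 (H.walk (show 2 * r + 1 ≤ 2 * N - 1 by omega))).join h2.symm
      (H.walk (show 2 * j + 1 + 1 ≤ 2 * r by omega)).symm).join h3.symm (.single t)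
    rw [show 2 * N - 1 + 1 = 2 * N by omega] at w
    refine H.hasPath F w ?_ ?_
    · rw [← seg_add v (Nat.zero_le (2 * j + 1 + 1)) (show 2 * j + 1 + 1 ≤ 2 * N by omega),
        ← seg_add v (show 2 * j + 1 + 1 ≤ 2 * r + 1 by omega) (show 2 * r + 1 ≤ 2 * N by omega)]
      abel
    · rw [← seg_add c (Nat.zero_le (2 * j + 1)) (show 2 * j + 1 ≤ 2 * N by omega),
        ← seg_add c (show 2 * j + 1 ≤ 2 * j + 1 + 1 by omega) (show 2 * j + 1 + 1 ≤ 2 * N by omega),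
        ← seg_add c (show 2 * j + 1 + 1 ≤ 2 * r by omega) (show 2 * r ≤ 2 * N by omega),
        ← seg_add c (show 2 * r ≤ 2 * r + 1 by omega) (show 2 * r + 1 ≤ 2 * N by omega),
        ← seg_add c (show 2 * r + 1 ≤ 2 * N - 1 by omega) (show 2 * N - 1 ≤ 2 * N by omega),
        seg_last c F.pos, seg_succ_self, seg_succ_self]
      abel

/-- The same second cycle, now cut at `v (2 * q) v (2 * q + 1)`. For `q = r` this edge is not on it;
then `s` enters at `v (2 * N - 1)` instead and the chord `h2` is not needed. -/
theorem hasPath_of_chord_even (H : IsSpanningCycle G X Y N s t v c β)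
    (F : IsDenseFamily G X Y N h) {r q : ℕ} (hr : r < N) (hq : q < N)
    (h1 : (G β).Adj s (v (2 * q + 1))) (h1' : (G β).Adj s (v (2 * N - 1)))
    (h2 : (G (c (2 * r))).Adj (v (2 * r)) (v (2 * N - 1)))
    (h3 : (G (c (2 * N - 1))).Adj t (v (2 * q)))
    (h4 : (G (c (2 * q))).Adj (v 0) (v (2 * r + 1))) :
    HasHamiltonianPathTransversal G s t := by
  rcases lt_trichotomy r q with hrq | rfl | hrq
  · have w := ((((ColoredWalk.single s).join h1
      (H.walk (show 2 * q + 1 ≤ 2 * N - 1 by omega))).join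
      h2.symm (H.walk (Nat.zero_le (2 * r))).symm).join h4
      (H.walk (show 2 * r + 1 ≤ 2 * q by omega))).join h3.symm (.single t)
    rw [show 2 * N - 1 + 1 = 2 * N by omega] at w
    refine H.hasPath F w ?_ ?_
    · rw [← seg_add v (Nat.zero_le (2 * r + 1)) (show 2 * r + 1 ≤ 2 * N by omega),
        ← seg_add v (show 2 * r + 1 ≤ 2 * q + 1 by omega) (show 2 * q + 1 ≤ 2 * N by omega)]
      abel
    · rw [← seg_add c (Nat.zero_le (2 * r)) (show 2 * r ≤ 2 * N by omega),
        ← seg_add c (show 2 * r ≤ 2 * r + 1 by omega) (show 2 * r + 1 ≤ 2 * N by omega),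
        ← seg_add c (show 2 * r + 1 ≤ 2 * q by omega) (show 2 * q ≤ 2 * N by omega),
        ← seg_add c (show 2 * q ≤ 2 * q + 1 by omega) (show 2 * q + 1 ≤ 2 * N by omega),
        ← seg_add c (show 2 * q + 1 ≤ 2 * N - 1 by omega) (show 2 * N - 1 ≤ 2 * N by omega),
        seg_last c F.pos, seg_succ_self, seg_succ_self]
      abel
  · have w := (((ColoredWalk.single s).join h1'
      (H.walk (show 2 * r + 1 ≤ 2 * N - 1 by omega)).symm).join
      h4.symm (H.walk (Nat.zero_le (2 * r)))).join h3.symm (.single t)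
    rw [show 2 * N - 1 + 1 = 2 * N by omega] at w
    refine H.hasPath F w ?_ ?_
    · rw [← seg_add v (Nat.zero_le (2 * r + 1)) (show 2 * r + 1 ≤ 2 * N by omega)]
      abel
    · rw [← seg_add c (Nat.zero_le (2 * r)) (show 2 * r ≤ 2 * N by omega),
        ← seg_add c (show 2 * r ≤ 2 * r + 1 by omega) (show 2 * r + 1 ≤ 2 * N by omega),
        ← seg_add c (show 2 * r + 1 ≤ 2 * N - 1 by omega) (show 2 * N - 1 ≤ 2 * N by omega),
        seg_last c F.pos, seg_succ_self]
      abel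
  · have w := ((((ColoredWalk.single s).join h1
      (H.walk (show 2 * q + 1 ≤ 2 * r by omega))).join
      h2 (H.walk (show 2 * r + 1 ≤ 2 * N - 1 by omega)).symm).join h4.symm
      (H.walk (Nat.zero_le (2 * q)))).join h3.symm (.single t)
    rw [show 2 * N - 1 + 1 = 2 * N by omega] at w
    refine H.hasPath F w ?_ ?_
    · rw [← seg_add v (Nat.zero_le (2 * q + 1)) (show 2 * q + 1 ≤ 2 * N by omega),
        ← seg_add v (show 2 * q + 1 ≤ 2 * r + 1 by omega) (show 2 * r + 1 ≤ 2 * N by omega)]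
      abel
    · rw [← seg_add c (Nat.zero_le (2 * q)) (show 2 * q ≤ 2 * N by omega),
        ← seg_add c (show 2 * q ≤ 2 * q + 1 by omega) (show 2 * q + 1 ≤ 2 * N by omega),
        ← seg_add c (show 2 * q + 1 ≤ 2 * r by omega) (show 2 * r ≤ 2 * N by omega),
        ← seg_add c (show 2 * r ≤ 2 * r + 1 by omega) (show 2 * r + 1 ≤ 2 * N by omega),
        ← seg_add c (show 2 * r + 1 ≤ 2 * N - 1 by omega) (show 2 * N - 1 ≤ 2 * N by omega),
        seg_last c F.pos, seg_succ_self, seg_succ_self]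
      abel

open Classical in
theorem hasPath_of_chords (H : IsSpanningCycle G X Y N s t v c β) (F : IsDenseFamily G X Y N h)
    (hI : N + 1 ≤ (chords G v c N (v (2 * N - 1))).card + h) :
    HasHamiltonianPathTransversal G s t := by
  by_contra hno
  set I := chords G v c N (v (2 * N - 1)) with hIdef
  have hpos := F.pos
  have hle := F.le
  have hsub : I ⊆ Finset.range N := Finset.filter_subset _ _
  have memI : ∀ {r}, r ∈ I → r < N ∧ (G (c (2 * r))).Adj (v (2 * r)) (v (2 * N - 1)) := by
    intro r hr
    simpa [hIdef, chords] using hr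
  -- In every colour `v 0` has at least `h` odd neighbours on the cycle, while `I` misses at most `h
  -- - 1` indices.
  have exI : ∀ i, ∃ r ∈ I, (G i).Adj (v 0) (v (2 * r + 1)) := by
    intro i
    by_contra! hcon
    have h1 := H.degree_left_le F i H.zero_mem
    have h2 : ((Finset.range N).filter fun r => (G i).Adj (v 0) (v (2 * r + 1))).card ≤
        (Finset.range N \ I).card := by
      refine Finset.card_le_card fun r hr => ?_
      rw [Finset.mem_filter] at hr
      exact Finset.mem_sdiff.2 ⟨hr.1, fun h3 => hcon r h3 hr.2⟩
    rw [Finset.card_sdiff_of_subset hsub, Finset.card_range] at h2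
    split_ifs at h1 <;> omega
  set U := (Finset.range N).filter fun r => (G β).Adj s (v (2 * r + 1)) with hUdef
  set W := (Finset.range N).filter fun r => (G (c (2 * N - 1))).Adj t (v (2 * r)) with hWdef
  have hU : h ≤ U.card := by
    rw [hUdef]
    have := H.degree_left_le F β H.left_mem
    split_ifs at this <;> omega
  have hW : h ≤ W.card := by
    rw [hWdef]
    have := H.degree_right_le F (c (2 * N - 1)) H.right_mem
    split_ifs at this <;> omega
  have memU : ∀ {r}, r ∈ U ↔ r < N ∧ (G β).Adj s (v (2 * r + 1)) := by simp [hUdef]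
  have memW : ∀ {r}, r ∈ W ↔ r < N ∧ (G (c (2 * N - 1))).Adj t (v (2 * r)) := by simp [hWdef]
  have hUI : ∃ r ∈ U, r ∈ I := by
    by_contra! hcon
    have h1 : (U ∪ I).card ≤ N := by
      simpa using Finset.card_le_card (Finset.union_subset (Finset.filter_subset _ _) hsub)
    rw [Finset.card_union_of_disjoint (Finset.disjoint_left.2 hcon)] at h1
    omega
  have h0W : 0 ∉ W := by
    intro h0
    obtain ⟨r, hrU, hrI⟩ := hUI
    exact hno (H.hasPath_of_chord_zero F (memI hrI).1 (memU.1 hrU).2 (memI hrI).2 (memW.1 h0).2)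
  have hstep : ∀ j ∈ U, j + 1 ∉ W := by
    intro j hj hj'
    obtain ⟨r, hrI, hr⟩ := exI (c (2 * j + 1))
    exact hno (H.hasPath_of_chord_odd F (memI hrI).1 (memW.1 hj').1 (memU.1 hj).2 (memI hrI).2
      (memW.1 hj').2 hr)
  -- Otherwise `U + 1` and `W` are disjoint subsets of `{1, …, N - 1}` with at least `2 * h ≥ N`
  -- elements together.
  have hlast : N - 1 ∈ U := by
    by_contra hcon
    have h1 : U.image (· + 1) ∪ W ⊆ (Finset.range N).erase 0 := by
      intro r hr
      rw [Finset.mem_union, Finset.mem_image] at hr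
      rw [Finset.mem_erase, Finset.mem_range]
      rcases hr with ⟨j, hj, rfl⟩ | hr
      · have : j ≠ N - 1 := fun h => hcon (h ▸ hj)
        have := (memU.1 hj).1
        omega
      · exact ⟨fun h => h0W (h ▸ hr), (memW.1 hr).1⟩
    have h2 := Finset.card_le_card h1
    rw [Finset.card_union_of_disjoint, Finset.card_image_of_injective _ (add_left_injective 1),
      Finset.card_erase_of_mem (Finset.mem_range.2 hpos), Finset.card_range] at h2
    · omega
    · rw [Finset.disjoint_left]
      intro r hr
      obtain ⟨j, hj, rfl⟩ := Finset.mem_image.1 hr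
      exact hstep j hj
  have hdisj : Disjoint U W := by
    rw [Finset.disjoint_left]
    intro q hqU hqW
    obtain ⟨r, hrI, hr⟩ := exI (c (2 * q))
    have h1 := (memU.1 hlast).2
    rw [show 2 * (N - 1) + 1 = 2 * N - 1 by omega] at h1
    exact hno (H.hasPath_of_chord_even F (memI hrI).1 (memU.1 hqU).1 (memU.1 hqU).2 h1
      (memI hrI).2 (memW.1 hqW).2 hr)
  have hcover : U ∪ W = Finset.range N := by
    refine Finset.eq_of_subset_of_card_le
      (Finset.union_subset (Finset.filter_subset _ _) (Finset.filter_subset _ _)) ?_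
    rw [Finset.card_union_of_disjoint hdisj, Finset.card_range]
    omega
  -- `U` and `W` partition the indices, `0` is not in `W`, and `U` is closed under successor; so `U`
  -- is everything, although `W` is nonempty.
  have hall : ∀ j < N, j ∈ U := by
    intro j
    induction j with
    | zero =>
      intro hj
      have := hcover.ge (Finset.mem_range.2 hj)
      exact (Finset.mem_union.1 this).resolve_right h0W
    | succ j ih =>
      intro hj
      have := hcover.ge (Finset.mem_range.2 hj)
      exact (Finset.mem_union.1 this).resolve_right (hstep j (ih (by omega)))
  have hWne : W.Nonempty := Finset.card_pos.1 (by omega)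
  obtain ⟨q, hq⟩ := hWne
  exact Finset.disjoint_left.1 hdisj (hall q (memW.1 hq).1) hq

open Classical in
/-- A rainbow closed walk through all vertices but `s` and `t` yields a transversal Hamiltonian
path between `s` and `t`. -/
theorem hasHamiltonianPathTransversal (H : IsSpanningCycle G X Y N s t v c β)
    (F : IsDenseFamily G X Y N h) : HasHamiltonianPathTransversal G s t := by
  by_contra hno
  have hpos := F.pos
  have hle := F.le
  have hU : h ≤ ((Finset.range N).filter fun r => (G β).Adj s (v (2 * r + 1))).card := by
    have := H.degree_left_le F β H.left_mem
    split_ifs at this <;> omega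
  have ht : (chords G v c N t).card + h ≤ N := by
    have h1 : Disjoint ((Finset.range N).filter fun r => (G β).Adj s (v (2 * r + 1)))
        (chords G v c N t) := by
      rw [Finset.disjoint_left]
      intro r hr hr'
      simp only [chords, Finset.mem_filter, Finset.mem_range] at hr hr'
      exact hno (H.hasPath_of_adj_adj F hr.1 hr.2 hr'.2)
    have hsub : chords G v c N t ⊆ Finset.range N := Finset.filter_subset _ _
    have h2 := Finset.card_le_card (Finset.union_subset
      (Finset.filter_subset (fun r => (G β).Adj s (v (2 * r + 1))) (Finset.range N)) hsub)
    rw [Finset.card_union_of_disjoint h1, Finset.card_range] at h2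
    omega
  -- Each `v (2 * r)` has degree at least `h + 1` in the colour `c (2 * r)`. If every odd vertex
  -- received at most `N - h ≤ h` of these edges, the total with those at `t` would be below `N * (h
  -- + 1)`.
  have key : ∃ p < N, N + 1 ≤ (chords G v c N (v (2 * p + 1))).card + h := by
    by_contra! hcon
    have h1 : ∑ r ∈ Finset.range N, ∑ p ∈ Finset.range N,
        (if (G (c (2 * r))).Adj (v (2 * r)) (v (2 * p + 1)) then 1 else 0) +
          (chords G v c N t).card ≥ N * (h + 1) := by
      rw [chords, Finset.card_filter, ← Finset.sum_add_distrib]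
      calc N * (h + 1) = ∑ r ∈ Finset.range N, (h + 1) := by simp
        _ ≤ _ := Finset.sum_le_sum fun r _ => by
          have := H.degree_left_le F (c (2 * r)) (H.even_mem F r)
          rw [Finset.card_filter] at this
          omega
    rw [Finset.sum_comm] at h1
    have h2 : ∑ p ∈ Finset.range N, ∑ r ∈ Finset.range N,
        (if (G (c (2 * r))).Adj (v (2 * r)) (v (2 * p + 1)) then 1 else 0) ≤ N * (N - h) := by
      calc _ ≤ ∑ p ∈ Finset.range N, (N - h) := Finset.sum_le_sum fun p hp => by
            have := hcon p (Finset.mem_range.1 hp)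
            rw [chords, Finset.card_filter] at this
            omega
        _ = _ := by simp
    have h3 : N * (N - h) ≤ N * h := Nat.mul_le_mul_left _ (by omega)
    rw [mul_add, mul_one] at h1
    omega
  obtain ⟨p, hp, hcard⟩ := key
  -- The rotation moves `v (2 * p + 1)` to position `2 * N - 1`.
  refine hno ((H.shift F (p + 1)).hasPath_of_chords F ?_)
  rw [H.card_chords_shift, show 2 * N - 1 + 2 * (p + 1) = 2 * p + 1 + 2 * N by omega,
    H.closed.period_vert]
  exact hcard

end Paths

end IsSpanningCycle

end SpanningCycle

/-! ### Closing a walk into a periodic sequence -/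

section Closing

variable {V ι : Type*} {G : ι → SimpleGraph V}

theorem ColoredWalk.exists_isClosedSeq {a b : V} {S : Multiset V} {C : Multiset ι} {i : ι} {K : ℕ}
    (hw : ColoredWalk G a b S C) (hi : (G i).Adj b a) (hK : S.card = K) :
    ∃ (v : ℕ → V) (c : ℕ → ι), IsClosedSeq G v c K ∧ v 0 = a ∧ seg v 0 K = S ∧
      seg c 0 K = C + {i} := by
  have : Nonempty ι := ⟨i⟩
  obtain ⟨v, c, h0, h1, hS, hC, hadj⟩ := hw.exists_seq
  have hcard := hw.card_eq
  obtain ⟨k, rfl⟩ : ∃ k, K = k + 1 := ⟨C.card, by omega⟩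
  have hk : C.card = k := by omega
  rw [hk] at h1 hS hC hadj
  have hmod : ∀ n < k + 1, n % (k + 1) = n := fun n hn => Nat.mod_eq_of_lt hn
  refine ⟨fun n => v (n % (k + 1)), fun n => if n % (k + 1) = k then i else c (n % (k + 1)),
    ⟨fun n => ?_, fun n => ?_, fun n => ?_⟩, by simpa using h0, ?_, ?_⟩
  · have hlt : n % (k + 1) < k + 1 := Nat.mod_lt n (Nat.succ_pos k)
    rw [Nat.add_mod n 1]
    split_ifs with hn
    · rw [hn]
      rcases Nat.eq_zero_or_pos k with rfl | hpos
      -- A walk with a single vertex would be closed by a loop.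
      · exact absurd (h1.symm.trans h0) hi.ne
      · rw [hmod 1 (by omega), Nat.mod_self, h0, h1]
        exact hi
    · rw [hmod 1 (by omega), hmod (n % (k + 1) + 1) (by omega)]
      exact hadj _ (by omega)
  · simp
  · simp
  · rw [hS]
    refine Multiset.map_congr rfl fun n hn => ?_
    rw [Multiset.mem_Ico] at hn
    rw [hmod n hn.2]
  · rw [← seg_add _ (Nat.zero_le k) (Nat.le_succ k), seg_succ_self, hmod k (by omega), if_pos rfl]
    congr 1
    rw [hC]
    refine Multiset.map_congr rfl fun n hn => ?_
    rw [Multiset.mem_Ico] at hn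
    rw [hmod n (by omega), if_neg (by omega)]

end Closing

/-! ### Crossing edges at the ends of a path -/

section Crossing

variable {V ι : Type*} [Fintype V] [Fintype ι] {G : ι → SimpleGraph V} {X Y : Finset V} {N h : ℕ}

namespace IsDenseFamily

omit [Fintype V] in
theorem right_mem_of_even (F : IsDenseFamily G X Y N h) {a b : V} {S : Multiset V}
    {C : Multiset ι} {l : ℕ} (hw : ColoredWalk G a b S C) (hl : S.card = 2 * l) (ha : a ∈ X) :
    b ∈ Y := by
  have : Nonempty ι := Fintype.card_pos_iff.1 (by rw [F.card_colors]; omega)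
  obtain ⟨v, c, rfl, rfl, hS, hC, hadj⟩ := hw.exists_seq
  have hcard := hw.card_eq
  have := (F.parity hadj ha (l - 1)).2 (by omega)
  rwa [show 2 * (l - 1) + 1 = C.card by omega] at this

-- By pigeonhole some `r` has `a` joined to `v (2 * r + 1)` in `β₁` and `b` to `v (2 * r)` in `β₂`.
-- Swapping the edge between these two for the crossing pair closes the path, and the colour `c (2 *
-- r)` drops out.
open Classical in
omit [Fintype V] in
theorem exists_closed_of_crossing (F : IsDenseFamily G X Y N h) {a b : V} {S : Multiset V}
    {C : Multiset ι} {l : ℕ} {β₁ β₂ : ι} {E₁ E₂ : Finset V} (hw : ColoredWalk G a b S C)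
    (hC : C.Nodup) (hl : S.card = 2 * l) (ha : a ∈ X) (h1 : β₁ ∉ C) (h2 : β₂ ∉ C)
    (h12 : β₁ ≠ β₂) (hE₁ : ∀ w, (G β₁).Adj a w → w ∈ E₁ ∨ w ∈ S)
    (hE₂ : ∀ w, (G β₂).Adj b w → w ∈ E₂ ∨ w ∈ S) (hcard : E₁.card + E₂.card + l < 2 * (h + 1)) :
    ∃ (v : ℕ → V) (c : ℕ → ι), IsClosedSeq G v c (2 * l) ∧ v 0 ∈ X ∧ seg v 0 (2 * l) = S ∧
      (seg c 0 (2 * l)).Nodup := by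
  have : Nonempty ι := ⟨β₁⟩
  have hb := F.right_mem_of_even hw hl ha
  obtain ⟨v, c, hva, hvb, hSv, hCc, hadj⟩ := hw.exists_seq
  have hcardS := hw.card_eq
  have hk : C.card = 2 * l - 1 := by omega
  have hl0 : 1 ≤ l := by omega
  rw [hk] at hvb hSv hCc hadj
  rw [show 2 * l - 1 + 1 = 2 * l by omega] at hSv
  have hpar := F.parity hadj (hva ▸ ha)
  have hA := F.degree_le β₁ a E₁ (Finset.range l) (fun r => v (2 * r + 1)) fun w hw => by
    refine (hE₁ w hw).imp_right fun hS => ?_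
    rw [hSv, mem_seg] at hS
    obtain ⟨k, -, hk, rfl⟩ := hS
    obtain ⟨r, rfl | rfl⟩ := Nat.even_or_odd' k
    · exact absurd (F.adj_left hw ha) (F.notMem_right ((hpar r).1 (by omega)))
    · exact ⟨r, Finset.mem_range.2 (by omega), rfl⟩
  have hB := F.degree_le β₂ b E₂ (Finset.range l) (fun r => v (2 * r)) fun w hw => by
    refine (hE₂ w hw).imp_right fun hS => ?_
    rw [hSv, mem_seg] at hS
    obtain ⟨k, -, hk, rfl⟩ := hS
    obtain ⟨r, rfl | rfl⟩ := Nat.even_or_odd' k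
    · exact ⟨r, Finset.mem_range.2 (by omega), rfl⟩
    · exact absurd ((hpar r).2 (by omega)) (F.notMem_right (F.adj_right hw hb))
  obtain ⟨r, hr1, hr2⟩ : ∃ r ∈ (Finset.range l).filter fun r => (G β₁).Adj a (v (2 * r + 1)),
      r ∈ (Finset.range l).filter fun r => (G β₂).Adj b (v (2 * r)) := by
    by_contra! hcon
    have h3 := Finset.card_le_card (Finset.union_subset
      (Finset.filter_subset (fun r => (G β₁).Adj a (v (2 * r + 1))) (Finset.range l))
      (Finset.filter_subset (fun r => (G β₂).Adj b (v (2 * r))) (Finset.range l)))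
    rw [Finset.card_union_of_disjoint (Finset.disjoint_left.2 hcon), Finset.card_range] at h3
    omega
  simp only [Finset.mem_filter, Finset.mem_range] at hr1 hr2
  obtain ⟨hr, hr1⟩ := hr1
  have w1 := ColoredWalk.of_seq v c (Nat.zero_le (2 * r)) fun i _ hi => hadj i (by omega)
  have w2 := ColoredWalk.of_seq v c (show 2 * r + 1 ≤ 2 * l - 1 by omega)
    fun i _ hi => hadj i (by omega)
  rw [hva] at w1
  rw [hvb] at w2
  obtain ⟨v', c', hcl, hv0, hv', hc'⟩ := (w1.join hr2.2.symm w2.symm).exists_isClosedSeq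
    (K := 2 * l) hr1.symm (by simp only [Multiset.card_add, card_seg]; omega)
  refine ⟨v', c', hcl, hv0 ▸ ha, ?_, ?_⟩
  · rw [hv', hSv, show 2 * l - 1 + 1 = 2 * l by omega, seg_add v (by omega) (by omega)]
  · have h3 : β₂ ::ₘ β₁ ::ₘ C = seg c' 0 (2 * l) + {c (2 * r)} := by
      rw [hc', hCc, ← seg_add c (Nat.zero_le (2 * r))
        (show 2 * r ≤ 2 * l - 1 by omega), ← seg_add c (show 2 * r ≤ 2 * r + 1 by omega)
        (show 2 * r + 1 ≤ 2 * l - 1 by omega), seg_succ_self, ← Multiset.singleton_add β₁,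
        ← Multiset.singleton_add β₂]
      abel
    have h4 : (β₂ ::ₘ β₁ ::ₘ C).Nodup := by
      simp [h1, h2, h12.symm, hC]
    rw [h3] at h4
    exact (Multiset.nodup_add.1 h4).1

omit [Fintype V] in
theorem exists_isSpanningCycle (F : IsDenseFamily G X Y N h) {s t : V} {v : ℕ → V} {c : ℕ → ι}
    (hcl : IsClosedSeq G v c (2 * N)) (hv : (seg v 0 (2 * N)).Nodup)
    (hc : (seg c 0 (2 * N)).Nodup) (hs : s ∈ X) (ht : t ∈ Y) (hs' : s ∉ seg v 0 (2 * N))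
    (ht' : t ∉ seg v 0 (2 * N)) (h0 : v 0 ∈ X) : ∃ β, IsSpanningCycle G X Y N s t v c β := by
  obtain ⟨β, hβ⟩ := F.exists_color (C := seg c 0 (2 * N)) (by simp [card_seg])
  exact ⟨β, hcl, hv, hc, hs, ht, hs', ht', h0, hβ⟩

theorem hasPath_of_card_eq_left [DecidableEq V] (F : IsDenseFamily G X Y N h) {s t a b : V}
    {S : Multiset V} {C : Multiset ι} (hw : ColoredWalk G a b S C) (hS : S.Nodup) (hC : C.Nodup)
    (hcard : S.card = 2 * N) (hs : s ∈ X) (ht : t ∈ Y) (hs' : s ∉ S) (ht' : t ∉ S) (ha : a ∈ X) :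
    HasHamiltonianPathTransversal G s t := by
  have hpos := F.pos
  have hle := F.le
  have hCcard := hw.card_eq
  have hst : s ≠ t := fun hst => F.notMem_right hs (hst ▸ ht)
  have hb := F.right_mem_of_even hw hcard ha
  obtain ⟨β₁, β₂, h1, h2, h12⟩ := F.exists_two_colors (C := C) (by omega)
  have hmem := F.mem_of_card hS hs' ht' hst hcard
  -- With at most one exceptional neighbour the crossing count is `1 + N < 2 * (h + 1)`. If both
  -- occur, `s` and `t` attach directly to the ends.
  have hfin : ∀ E₁ E₂ : Finset V, E₁.card + E₂.card ≤ 1 →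
      (∀ w, (G β₁).Adj a w → w ∈ E₁ ∨ w ∈ S) → (∀ w, (G β₂).Adj b w → w ∈ E₂ ∨ w ∈ S) →
      HasHamiltonianPathTransversal G s t := by
    intro E₁ E₂ hE hE₁ hE₂
    obtain ⟨v, c, hcl, h0, rfl, hc⟩ :=
      F.exists_closed_of_crossing hw hC hcard ha h1 h2 h12 hE₁ hE₂ (by omega)
    obtain ⟨β, H⟩ := F.exists_isSpanningCycle hcl hS hc hs ht hs' ht' h0
    exact H.hasHamiltonianPathTransversal F
  have hX : ∀ {i w}, (G i).Adj a w → w = t ∨ w ∈ S := fun {i w} hw =>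
    (hmem w).resolve_left fun hws => F.notMem_right hs (hws ▸ F.adj_left hw ha)
  have hY : ∀ {i w}, (G i).Adj b w → w = s ∨ w ∈ S := fun {i w} hw =>
    (hmem w).imp_right fun h => h.resolve_left fun hwt =>
      F.notMem_right (F.adj_right hw hb) (hwt ▸ ht)
  by_cases hat : (G β₁).Adj a t
  · by_cases hbs : (G β₂).Adj b s
    · refine F.hasPath ((ColoredWalk.cons hbs.symm hw.symm).join hat (.single t)) ?_ ?_ ?_
      · rw [add_comm, Multiset.singleton_add]
        simp [hS, hs', ht', hst.symm]
      · rw [add_zero, add_comm, Multiset.singleton_add]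
        simp [hC, h1, h2, h12]
      · simp [hcard]
    · refine hfin {t} ∅ (by simp) (fun w hw => by simpa using hX hw) fun w hw => Or.inr ?_
      exact (hY hw).resolve_left fun h => hbs (h ▸ hw)
  · refine hfin ∅ {s} (by simp) (fun w hw => Or.inr ?_) fun w hw => by simpa using hY hw
    exact (hX hw).resolve_left fun h => hat (h ▸ hw)

theorem hasPath_of_card_eq [DecidableEq V] (F : IsDenseFamily G X Y N h) {s t a b : V}
    {S : Multiset V} {C : Multiset ι} (hw : ColoredWalk G a b S C) (hS : S.Nodup) (hC : C.Nodup)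
    (hcard : S.card = 2 * N) (hs : s ∈ X) (ht : t ∈ Y) (hs' : s ∉ S) (ht' : t ∉ S) :
    HasHamiltonianPathTransversal G s t := by
  rcases F.cover a with ha | ha
  · exact F.hasPath_of_card_eq_left hw hS hC hcard hs ht hs' ht' ha
  · exact F.hasPath_of_card_eq_left hw.symm hS hC hcard hs ht hs' ht'
      (F.symm.right_mem_of_even hw hcard ha)

end IsDenseFamily

end Crossing

/-! ### Longest rainbow paths avoiding `s` and `t` -/

section LongestPath

variable {V ι : Type*} {G : ι → SimpleGraph V} {s t : V} {K : ℕ}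

/-- Every rainbow path avoiding `s` and `t` has at most `K` vertices. -/
def PathsBounded (G : ι → SimpleGraph V) (s t : V) (K : ℕ) : Prop :=
  ∀ ⦃a b : V⦄ ⦃S : Multiset V⦄ ⦃C : Multiset ι⦄, ColoredWalk G a b S C → S.Nodup → C.Nodup →
    s ∉ S → t ∉ S → S.card ≤ K

theorem PathsBounded.symm (B : PathsBounded G s t K) : PathsBounded G t s K :=
  fun _ _ _ _ hw hS hC hs ht => B hw hS hC ht hs

theorem PathsBounded.not_adj (B : PathsBounded G s t K) {a b z : V} {S : Multiset V}
    {C : Multiset ι} {i : ι} (hw : ColoredWalk G a b S C) (hS : S.Nodup) (hC : C.Nodup)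
    (hs : s ∉ S) (ht : t ∉ S) (hK : S.card = K) (hi : i ∉ C) (hz : z ∉ S) (hzs : z ≠ s)
    (hzt : z ≠ t) : ¬ (G i).Adj a z := by
  intro hadj
  have := B (ColoredWalk.cons hadj.symm hw) (Multiset.nodup_cons.2 ⟨hz, hS⟩)
    (Multiset.nodup_cons.2 ⟨hi, hC⟩) (by simp [hs, hzs.symm]) (by simp [ht, hzt.symm])
  rw [Multiset.card_cons] at this
  omega

theorem IsClosedSeq.mem_seg {v : ℕ → V} {c : ℕ → ι} (H : IsClosedSeq G v c K) (hK : 0 < K)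
    (n : ℕ) : v n ∈ seg v 0 K := by
  rw [← seg_periodic H.period_vert n]
  exact BipartiteTransversal.mem_seg.2 ⟨n, le_rfl, by omega, rfl⟩

/-- Supplies the fresh colours for recolouring a cycle. -/
theorem exists_seq_nodup [Nonempty ι] {T : Finset ι} {m : ℕ} (hm : m ≤ T.card) :
    ∃ d : ℕ → ι, (∀ i < m, d i ∈ T) ∧ (seg d 0 m).Nodup := by
  let e := T.equivFin.symm
  refine ⟨fun i => if hi : i < T.card then e ⟨i, hi⟩ else Classical.arbitrary ι, fun i hi => ?_, ?_⟩
  · have hi' : i < T.card := by omega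
    simp [hi']
  · refine Multiset.Nodup.map_on (fun i hi j hj hij => ?_) (Multiset.nodup_Ico)
    rw [Multiset.mem_Ico] at hi hj
    rw [dif_pos (by omega), dif_pos (by omega)] at hij
    simpa using e.injective (Subtype.ext hij)

/-- No edge of a colour missing from a longest closed walk leaves it. -/
theorem PathsBounded.not_adj_of_isClosedSeq (B : PathsBounded G s t K) {v : ℕ → V} {c : ℕ → ι}
    (H : IsClosedSeq G v c K) (hv : (seg v 0 K).Nodup) (hc : (seg c 0 K).Nodup)
    (hs : s ∉ seg v 0 K) (ht : t ∉ seg v 0 K) {i : ι} (hi : i ∉ seg c 0 K) {p z : V}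
    (hp : p ∈ seg v 0 K) (hz : z ∉ seg v 0 K) (hzs : z ≠ s) (hzt : z ≠ t) : ¬ (G i).Adj p z := by
  obtain ⟨k, -, hk, rfl⟩ := mem_seg.1 hp
  have hw := ColoredWalk.of_seq v c (show k ≤ k + (K - 1) by omega) fun j _ _ => H.adj j
  rw [show k + (K - 1) + 1 = k + K by omega, seg_periodic H.period_vert] at hw
  have hle : seg c k (k + (K - 1)) ≤ seg c 0 K := by
    rw [← seg_periodic H.period_color k, ← seg_add c (show k ≤ k + (K - 1) by omega)
      (show k + (K - 1) ≤ k + K by omega)]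
    exact Multiset.le_add_right _ _
  exact B.not_adj hw hv (Multiset.nodup_of_le hle hc) hs ht (by simp [card_seg])
    (fun h => hi (Multiset.mem_of_le hle h)) hz hzs hzt

end LongestPath

/-! ### A longest path that misses further vertices -/

section Extremal

variable {V ι : Type*} [Fintype V] [Fintype ι] {G : ι → SimpleGraph V} {X Y : Finset V} {N h : ℕ}
  {s t : V}

namespace IsDenseFamily

-- Let `z ∈ Y` lie off the path, `z ≠ t`. If `z` meets `v (2 * r)` in `β₁` and `a` meets `v (2 * r +
-- 1)` in `β₂`, rotation makes `v (2 * r)` an end and `z` extends the path. Otherwise the index sets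
-- are disjoint, so `(h + 1 - (N - l)) + h ≤ l`, against `N ≤ 2 * h`.
open Classical in
omit [Fintype V] in
theorem not_odd_of_left (F : IsDenseFamily G X Y N h) {a b : V} {S : Multiset V} {C : Multiset ι}
    {l : ℕ} (B : PathsBounded G s t (2 * l + 1)) (hw : ColoredWalk G a b S C) (hS : S.Nodup)
    (hC : C.Nodup) (hs' : s ∉ S) (ht' : t ∉ S) (hl : S.card = 2 * l + 1) (hlN : l < N)
    (hs : s ∈ X) (ha : a ∈ X) : False := by
  have : Nonempty ι := Fintype.card_pos_iff.1 (by rw [F.card_colors]; omega)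
  have hw' := hw
  obtain ⟨v, c, hva, hvb, hSv, hCc, hadj⟩ := hw.exists_seq
  have hk : C.card = 2 * l := by have := hw.card_eq; omega
  rw [hk] at hvb hSv hCc hadj
  have hpar := F.parity hadj (hva ▸ ha)
  have hle := F.le
  obtain ⟨β₁, β₂, h1, h2, h12⟩ := F.exists_two_colors (C := C) (by omega)
  have hmem : ∀ k < 2 * l + 1, v k ∈ S := fun k hk => hSv ▸ mem_seg.2 ⟨k, by omega, hk, rfl⟩
  obtain ⟨z, hzY, hz⟩ : ∃ z ∈ Y, z ∉ insert t ((Finset.range l).image fun r => v (2 * r + 1)) := by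
    refine Finset.exists_mem_notMem_of_card_lt_card ?_
    refine (Finset.card_insert_le _ _).trans_lt ?_
    have := Finset.card_image_le (s := Finset.range l) (f := fun r => v (2 * r + 1))
    rw [Finset.card_range] at this
    rw [F.card_right]
    omega
  simp only [Finset.mem_insert, Finset.mem_image, Finset.mem_range, not_or, not_exists,
    not_and] at hz
  obtain ⟨hzt, hz⟩ := hz
  have hzS : z ∉ S := by
    rw [hSv, mem_seg]
    rintro ⟨k, -, hk, rfl⟩
    obtain ⟨r, rfl | rfl⟩ := Nat.even_or_odd' k
    · exact F.notMem_right ((hpar r).1 (by omega)) hzY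
    · exact hz r (by omega) rfl
  have hzs : z ≠ s := fun h => F.notMem_right hs (h ▸ hzY)
  have hB := F.degree_le β₂ a {t} (Finset.range l) (fun r => v (2 * r + 1)) fun w hw => by
    by_contra! hcon
    have hwY := F.adj_left hw ha
    refine B.not_adj hw' hS hC hs' ht' hl h2 (fun hwS => ?_) (fun h => F.notMem_right hs (h ▸ hwY))
      (by simpa using hcon.1) hw
    rw [hSv, mem_seg] at hwS
    obtain ⟨k, -, hk, rfl⟩ := hwS
    obtain ⟨r, rfl | rfl⟩ := Nat.even_or_odd' k
    · exact F.notMem_right ((hpar r).1 (by omega)) hwY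
    · exact hcon.2 r (Finset.mem_range.2 (by omega)) rfl
  have himg : (Finset.range (l + 1)).image (fun r => v (2 * r)) ⊆ X := by
    intro w hw
    obtain ⟨r, hr, rfl⟩ := Finset.mem_image.1 hw
    rw [Finset.mem_range] at hr
    exact (hpar r).1 (by omega)
  have himgcard : ((Finset.range (l + 1)).image fun r => v (2 * r)).card = l + 1 := by
    rw [Finset.card_image_of_injOn, Finset.card_range]
    intro r hr r' hr' hrr'
    simp only [Finset.coe_range, Set.mem_Iio] at hr hr'
    have := seg_injOn (hSv ▸ hS) (Nat.zero_le _) (show 2 * r < 2 * l + 1 by omega) (Nat.zero_le _)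
      (show 2 * r' < 2 * l + 1 by omega) hrr'
    omega
  have hA := F.degree_le β₁ z (X \ (Finset.range (l + 1)).image fun r => v (2 * r))
    (Finset.range (l + 1)) (fun r => v (2 * r)) fun w hw => by
    rw [Finset.mem_sdiff, Finset.mem_image]
    have := F.adj_right hw hzY
    tauto
  rw [Finset.card_sdiff_of_subset himg, himgcard, F.card_left] at hA
  -- The index `l` is the far end `b`, which `z` would extend.
  have hAl : (Finset.range (l + 1)).filter (fun r => (G β₁).Adj z (v (2 * r))) ⊆
      (Finset.range l).filter (fun r => (G β₁).Adj z (v (2 * r))) := by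
    intro r hr
    simp only [Finset.mem_filter, Finset.mem_range] at hr ⊢
    refine ⟨?_, hr.2⟩
    have : r ≠ l := by
      rintro rfl
      exact B.not_adj hw'.symm hS hC hs' ht' hl h1 hzS hzs hzt (hvb ▸ hr.2.symm)
    omega
  have hAl' := Finset.card_le_card hAl
  have hdisj : Disjoint ((Finset.range l).filter fun r => (G β₁).Adj z (v (2 * r)))
      ((Finset.range l).filter fun r => (G β₂).Adj a (v (2 * r + 1))) := by
    rw [Finset.disjoint_left]
    intro r hr hr'
    simp only [Finset.mem_filter, Finset.mem_range] at hr hr'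
    have w1 := ColoredWalk.of_seq v c (Nat.zero_le (2 * r)) fun i _ hi => hadj i (by omega)
    have w2 := ColoredWalk.of_seq v c (show 2 * r + 1 ≤ 2 * l by omega)
      fun i _ hi => hadj i (by omega)
    rw [hva] at w1
    have w3 := w1.symm.join hr'.2 w2
    rw [seg_add v (by omega) (by omega), ← hSv] at w3
    have hcol : seg c 0 (2 * r) + {β₂} + seg c (2 * r + 1) (2 * l) ≤ β₂ ::ₘ C := by
      rw [hCc, ← seg_add c (Nat.zero_le (2 * r)) (show 2 * r ≤ 2 * l by omega),
        ← seg_add c (show 2 * r ≤ 2 * r + 1 by omega) (show 2 * r + 1 ≤ 2 * l by omega),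
        ← Multiset.singleton_add, Multiset.le_iff_exists_add]
      exact ⟨seg c (2 * r) (2 * r + 1), by abel⟩
    refine B.not_adj w3 hS (Multiset.nodup_of_le hcol (Multiset.nodup_cons.2 ⟨h2, hC⟩)) hs' ht' hl
      (fun h => ?_) hzS hzs hzt hr.2.symm
    have := Multiset.mem_of_le hcol h
    rw [Multiset.mem_cons] at this
    tauto
  have hU := Finset.card_le_card (Finset.union_subset
    (Finset.filter_subset (fun r => (G β₁).Adj z (v (2 * r))) (Finset.range l))
    (Finset.filter_subset (fun r => (G β₂).Adj a (v (2 * r + 1))) (Finset.range l)))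
  rw [Finset.card_union_of_disjoint hdisj, Finset.card_range] at hU
  rw [Finset.card_singleton] at hB
  omega

omit [Fintype V] in
theorem not_odd (F : IsDenseFamily G X Y N h) {a b : V} {S : Multiset V} {C : Multiset ι}
    {l : ℕ} (B : PathsBounded G s t (2 * l + 1)) (hw : ColoredWalk G a b S C) (hS : S.Nodup)
    (hC : C.Nodup) (hs' : s ∉ S) (ht' : t ∉ S) (hl : S.card = 2 * l + 1) (hlN : l < N)
    (hs : s ∈ X) (ht : t ∈ Y) : False := by
  rcases F.cover a with ha | ha
  · exact F.not_odd_of_left B hw hS hC hs' ht' hl hlN hs ha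
  · exact F.symm.not_odd_of_left B.symm hw hS hC ht' hs' hl hlN ht ha

omit [Fintype V] in
theorem exists_closed_of_even_left (F : IsDenseFamily G X Y N h) {a b : V} {S : Multiset V}
    {C : Multiset ι} {l : ℕ} (B : PathsBounded G s t (2 * l)) (hw : ColoredWalk G a b S C)
    (hS : S.Nodup) (hC : C.Nodup) (hs' : s ∉ S) (ht' : t ∉ S) (hl : S.card = 2 * l) (hlN : l < N)
    (hs : s ∈ X) (ht : t ∈ Y) (ha : a ∈ X) :
    ∃ (v : ℕ → V) (c : ℕ → ι), IsClosedSeq G v c (2 * l) ∧ v 0 ∈ X ∧ seg v 0 (2 * l) = S ∧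
      (seg c 0 (2 * l)).Nodup := by
  have hCcard := hw.card_eq
  have hb := F.right_mem_of_even hw hl ha
  obtain ⟨β₁, β₂, h1, h2, h12⟩ := F.exists_two_colors (C := C) (by omega)
  refine F.exists_closed_of_crossing (E₁ := {t}) (E₂ := {s}) hw hC hl ha h1 h2 h12
    (fun w hwa => ?_) (fun w hwb => ?_) ?_
  · by_contra! hcon
    exact B.not_adj hw hS hC hs' ht' hl h1 hcon.2
      (fun h => F.notMem_right hs (h ▸ F.adj_left hwa ha)) (by simpa using hcon.1) hwa
  · by_contra! hcon
    exact B.not_adj hw.symm hS hC hs' ht' hl h2 hcon.2 (by simpa using hcon.1)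
      (fun h => F.notMem_right (F.adj_right hwb hb) (h ▸ ht)) hwb
  · have := F.le
    simp only [Finset.card_singleton]
    omega

omit [Fintype V] in
theorem exists_closed_of_even (F : IsDenseFamily G X Y N h) {a b : V} {S : Multiset V}
    {C : Multiset ι} {l : ℕ} (B : PathsBounded G s t (2 * l)) (hw : ColoredWalk G a b S C)
    (hS : S.Nodup) (hC : C.Nodup) (hs' : s ∉ S) (ht' : t ∉ S) (hl : S.card = 2 * l) (hlN : l < N)
    (hs : s ∈ X) (ht : t ∈ Y) :
    ∃ (v : ℕ → V) (c : ℕ → ι), IsClosedSeq G v c (2 * l) ∧ v 0 ∈ X ∧ seg v 0 (2 * l) = S ∧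
      (seg c 0 (2 * l)).Nodup := by
  rcases F.cover a with ha | ha
  · exact F.exists_closed_of_even_left B hw hS hC hs' ht' hl hlN hs ht ha
  · exact F.exists_closed_of_even_left B hw.symm hS hC hs' ht' hl hlN hs ht
      (F.symm.right_mem_of_even hw hl ha)

end IsDenseFamily

end Extremal

/-! ### Recognising the extremal graphs -/

section Extremal

variable {V ι : Type*} [Fintype V] [Fintype ι] {G : ι → SimpleGraph V} {X Y : Finset V} {N h : ℕ}
  {s t : V}

omit [Fintype V] in
theorem graphF_adj {x y : V} {X₁ X₂ Y₁ Y₂ : Finset V} {u w : V} :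
    (graphF x y X₁ X₂ Y₁ Y₂).Adj u w ↔ u ≠ w ∧
      (((u = x ∧ (w ∈ Y₁ ∨ w ∈ Y₂)) ∨ ((u ∈ X₁ ∨ u ∈ X₂) ∧ w = y) ∨
        (u ∈ X₁ ∧ w ∈ Y₁) ∨ (u ∈ X₂ ∧ w ∈ Y₂)) ∨
      ((w = x ∧ (u ∈ Y₁ ∨ u ∈ Y₂)) ∨ ((w ∈ X₁ ∨ w ∈ X₂) ∧ u = y) ∨
        (w ∈ X₁ ∧ u ∈ Y₁) ∨ (w ∈ X₂ ∧ u ∈ Y₂))) :=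
  SimpleGraph.fromRel_adj _ _ _

namespace IsDenseFamily

omit [Fintype V] in
theorem adj_of_subset (F : IsDenseFamily G X Y N h) {i : ι} {z : V} {T : Finset V}
    (hT : ∀ w, (G i).Adj z w → w ∈ T) (hcard : T.card ≤ h + 1) {w : V} (hw : w ∈ T) :
    (G i).Adj z w := by
  have := Set.eq_of_subset_of_ncard_le (s := (G i).neighborSet z) (t := (T : Set V)) hT
    (by rw [Set.ncard_coe_finset]; exact hcard.trans (F.degree i z)) (Finset.finite_toSet T)
  exact this.ge hw

-- A vertex other than `s` and `t` has only `h + 1` permitted neighbours, so the degree bound forces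
-- all of them. Only the edge `st` remains free.
omit [Fintype V] in
theorem eq_graphF_or_eq_graphF' [DecidableEq V] (F : IsDenseFamily G X Y N h)
    {X₁ X₂ Y₁ Y₂ : Finset V} (hX : IsSplit X s X₁ X₂ h) (hY : IsSplit Y t Y₁ Y₂ h) (i : ι)
    (h12 : ∀ x ∈ X₁, ∀ y ∈ Y₂, ¬ (G i).Adj x y) (h21 : ∀ x ∈ X₂, ∀ y ∈ Y₁, ¬ (G i).Adj x y) :
    G i = graphF s t X₁ X₂ Y₁ Y₂ ∨ G i = graphF' s t X₁ X₂ Y₁ Y₂ := by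
  have memX : ∀ z, z ∈ X ↔ z = s ∨ z ∈ X₁ ∨ z ∈ X₂ := by
    intro z; rw [hX.union_eq]; simp
  have memY : ∀ z, z ∈ Y ↔ z = t ∨ z ∈ Y₁ ∨ z ∈ Y₂ := by
    intro z; rw [hY.union_eq]; simp
  have hdX : ∀ z ∈ X₁, z ∉ X₂ := fun z hz => Finset.disjoint_left.1 hX.disjoint hz
  have hdY : ∀ z ∈ Y₁, z ∉ Y₂ := fun z hz => Finset.disjoint_left.1 hY.disjoint hz
  have hdisj : ∀ z ∈ X, z ∉ Y := fun z => F.notMem_right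
  have aX₁ : ∀ x ∈ X₁, ∀ y ∈ insert t Y₁, (G i).Adj x y := by
    intro x hx y hy
    refine F.adj_of_subset (fun w hw => ?_) (by simp [hY.notMem_left, hY.card_left]) hy
    have h1 := (memY w).1 (F.adj_left hw ((memX x).2 (by simp [hx])))
    have h2 := fun h => h12 x hx w h hw
    rw [Finset.mem_insert]; tauto
  have aX₂ : ∀ x ∈ X₂, ∀ y ∈ insert t Y₂, (G i).Adj x y := by
    intro x hx y hy
    refine F.adj_of_subset (fun w hw => ?_) (by simp [hY.notMem_right, hY.card_right]) hy
    have h1 := (memY w).1 (F.adj_left hw ((memX x).2 (by simp [hx])))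
    have h2 := fun h => h21 x hx w h hw
    rw [Finset.mem_insert]; tauto
  have aY₁ : ∀ y ∈ Y₁, (G i).Adj y s := by
    intro y hy
    refine F.adj_of_subset (T := insert s X₁) (fun w hw => ?_)
      (by simp [hX.notMem_left, hX.card_left]) (by simp)
    have h1 := (memX w).1 (F.adj_right hw ((memY y).2 (by simp [hy])))
    have h2 := fun h => h21 w h y hy hw.symm
    rw [Finset.mem_insert]; tauto
  have aY₂ : ∀ y ∈ Y₂, (G i).Adj y s := by
    intro y hy
    refine F.adj_of_subset (T := insert s X₂) (fun w hw => ?_)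
      (by simp [hX.notMem_right, hX.card_right]) (by simp)
    have h1 := (memX w).1 (F.adj_right hw ((memY y).2 (by simp [hy])))
    have h2 := fun h => h12 w h y hy hw.symm
    rw [Finset.mem_insert]; tauto
  have hs : s ∈ X := (memX s).2 (by simp)
  have ht : t ∈ Y := (memY t).2 (by simp)
  have key : ∀ x ∈ X, ∀ y ∈ Y, (G i).Adj x y ↔
      (graphF s t X₁ X₂ Y₁ Y₂).Adj x y ∨ (x = s ∧ y = t ∧ (G i).Adj s t) := by
    intro x hx y hy
    have hxY : x ≠ t ∧ x ∉ Y₁ ∧ x ∉ Y₂ := by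
      have := F.notMem_right hx
      rwa [memY, not_or, not_or] at this
    have hyX : y ≠ s ∧ y ∉ X₁ ∧ y ∉ X₂ := by
      have := F.symm.notMem_right hy
      rwa [memX, not_or, not_or] at this
    have hxy : x ≠ y := fun h => F.notMem_right hx (h ▸ hy)
    rw [graphF_adj]
    simp only [hxY, hyX, ne_eq, hxy, not_false_eq_true, and_false, or_false, true_and]
    have nX := hX.notMem_left
    have nX' := hX.notMem_right
    have nY := hY.notMem_left
    have nY' := hY.notMem_right
    rcases (memX x).1 hx with rfl | hx | hx <;> rcases (memY y).1 hy with rfl | hy | hy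
    · simp [nX, nX', nY, nY']
    · simp [nX, nX', hy, (aY₁ y hy).symm]
    · simp [nX, nX', hy, (aY₂ y hy).symm]
    · simp [hx, aX₁ x hx _ (Finset.mem_insert_self _ _)]
    · simp [hx, hy, aX₁ x hx y (Finset.mem_insert_of_mem hy)]
    · have e1 : y ∉ Y₁ := fun h => hdY y h hy
      have e2 : x ≠ s := fun h => nX (h ▸ hx)
      have e3 : y ≠ t := fun h => nY' (h ▸ hy)
      simp [h12 x hx y hy, e1, e2, e3, hdX x hx]
    · simp [hx, aX₂ x hx _ (Finset.mem_insert_self _ _)]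
    · have e1 : x ∉ X₁ := fun h => hdX x h hx
      have e2 : x ≠ s := fun h => nX' (h ▸ hx)
      have e3 : y ≠ t := fun h => nY (h ▸ hy)
      simp [h21 x hx y hy, e1, e2, e3, hdY y hy]
    · simp [hx, hy, aX₂ x hx y (Finset.mem_insert_of_mem hy)]
  have ext : ∀ H : SimpleGraph V, (∀ u w, H.Adj u w → (u ∈ X ↔ w ∈ Y)) →
      (∀ x ∈ X, ∀ y ∈ Y, (G i).Adj x y ↔ H.Adj x y) → G i = H := by
    intro H hH hXY
    ext u w
    rcases F.cover u with hu | hu <;> rcases F.cover w with hw | hw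
    · have h1 := fun h => F.notMem_right hw (F.adj_left (i := i) (a := u) (b := w) h hu)
      have h2 := fun h => F.notMem_right hw ((hH u w h).1 hu)
      tauto
    · exact hXY u hu w hw
    · rw [(G i).adj_comm, H.adj_comm]
      exact hXY w hw u hu
    · have h1 := fun h => F.notMem_right (F.adj_right (i := i) (a := u) (b := w) h hu) hw
      have h2 := fun h => F.notMem_right ((hH u w h).2 hw) hu
      tauto
  have hF : ∀ u w, (graphF s t X₁ X₂ Y₁ Y₂).Adj u w → (u ∈ X ↔ w ∈ Y) := by
    intro u w h
    have hu := hdisj u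
    have hw := hdisj w
    rw [memX, memY] at hu hw
    rw [graphF_adj] at h
    rw [memX, memY]
    clear * - h hu hw
    tauto
  by_cases hadj : (G i).Adj s t
  · refine Or.inr (ext _ (fun u w h => ?_) fun x hx y hy => ?_)
    · rw [graphF', SimpleGraph.sup_adj, SimpleGraph.edge_adj] at h
      rcases h with h | ⟨⟨rfl, rfl⟩ | ⟨rfl, rfl⟩, -⟩
      · exact hF u w h
      · exact iff_of_true hs ht
      · exact iff_of_false (fun h => F.notMem_right h ht) (F.notMem_right hs)
    · have hxy : x ≠ y := fun h => F.notMem_right hx (h ▸ hy)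
      have hxt : x ≠ t := fun h => F.notMem_right hx (h ▸ ht)
      rw [key x hx y hy, graphF', SimpleGraph.sup_adj, SimpleGraph.edge_adj]
      simp [hadj, hxy, hxt, eq_comm]
  · refine Or.inl (ext _ hF fun x hx y hy => ?_)
    rw [key x hx y hy]
    simp [hadj]

omit [Fintype V] in
theorem exists_split_of_closed [DecidableEq V] (F : IsDenseFamily G X Y N h) {l : ℕ}
    {v : ℕ → V} {c : ℕ → ι} (B : PathsBounded G s t (2 * l)) (H : IsClosedSeq G v c (2 * l))
    (h0 : v 0 ∈ X)
    (hv : (seg v 0 (2 * l)).Nodup) (hc : (seg c 0 (2 * l)).Nodup) (hs' : s ∉ seg v 0 (2 * l))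
    (ht' : t ∉ seg v 0 (2 * l)) (hl : 1 ≤ l) (hlN : l < N) (hs : s ∈ X) (ht : t ∈ Y) :
    ∃ X₁ X₂ Y₁ Y₂ : Finset V, IsSplit X s X₁ X₂ h ∧ IsSplit Y t Y₁ Y₂ h ∧ N = 2 * h ∧
      ∀ i, G i = graphF s t X₁ X₂ Y₁ Y₂ ∨ G i = graphF' s t X₁ X₂ Y₁ Y₂ := by
  classical
  have hle := F.le
  have hpar := fun i => F.parity (k := 2 * i + 1) (fun i _ => H.adj i) h0 i
  have heven : ∀ i, v (2 * i) ∈ X := fun i => (hpar i).1 (by omega)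
  have hodd : ∀ i, v (2 * i + 1) ∈ Y := fun i => (hpar i).2 le_rfl
  have hmem : ∀ n, v n ∈ seg v 0 (2 * l) := H.mem_seg (by omega)
  have hst : s ≠ t := fun h => F.notMem_right hs (h ▸ ht)
  set A := (Finset.range l).image fun r => v (2 * r) with hA
  set A' := (Finset.range l).image fun r => v (2 * r + 1) with hA'
  have memA : ∀ x ∈ X, x ∈ A ↔ x ∈ seg v 0 (2 * l) := by
    intro x hx
    rw [hA, Finset.mem_image, mem_seg]
    constructor
    · rintro ⟨r, hr, rfl⟩
      exact ⟨2 * r, by omega, by rw [Finset.mem_range] at hr; omega, rfl⟩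
    · rintro ⟨k, -, hk, rfl⟩
      obtain ⟨r, rfl | rfl⟩ := Nat.even_or_odd' k
      · exact ⟨r, Finset.mem_range.2 (by omega), rfl⟩
      · exact absurd (hodd r) (F.notMem_right hx)
  have memA' : ∀ y ∈ Y, y ∈ A' ↔ y ∈ seg v 0 (2 * l) := by
    intro x hx
    rw [hA', Finset.mem_image, mem_seg]
    constructor
    · rintro ⟨r, hr, rfl⟩
      exact ⟨2 * r + 1, by omega, by rw [Finset.mem_range] at hr; omega, rfl⟩
    · rintro ⟨k, -, hk, rfl⟩
      obtain ⟨r, rfl | rfl⟩ := Nat.even_or_odd' k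
      · exact absurd hx (F.notMem_right (heven r))
      · exact ⟨r, Finset.mem_range.2 (by omega), rfl⟩
  have hAX : A ⊆ X := by
    intro x hx
    obtain ⟨r, -, rfl⟩ := Finset.mem_image.1 hx
    exact heven r
  have hAY : A' ⊆ Y := by
    intro x hx
    obtain ⟨r, -, rfl⟩ := Finset.mem_image.1 hx
    exact hodd r
  have hAcard : A.card = l := by
    rw [hA, Finset.card_image_of_injOn, Finset.card_range]
    intro r hr r' hr' hrr'
    simp only [Finset.coe_range, Set.mem_Iio] at hr hr'
    have := seg_injOn hv (Nat.zero_le _) (show 2 * r < 2 * l by omega) (Nat.zero_le _)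
      (show 2 * r' < 2 * l by omega) hrr'
    omega
  have hA'card : A'.card = l := by
    rw [hA', Finset.card_image_of_injOn, Finset.card_range]
    intro r hr r' hr' hrr'
    simp only [Finset.coe_range, Set.mem_Iio] at hr hr'
    have := seg_injOn hv (Nat.zero_le _) (show 2 * r + 1 < 2 * l by omega) (Nat.zero_le _)
      (show 2 * r' + 1 < 2 * l by omega) hrr'
    omega
  have hsA : s ∉ A := fun h => hs' ((memA s hs).1 h)
  have htA : t ∉ A' := fun h => ht' ((memA' t ht).1 h)
  have hfree : ∀ i, i ∉ seg c 0 (2 * l) → ∀ p ∈ seg v 0 (2 * l), ∀ z ∉ seg v 0 (2 * l), z ≠ s →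
      z ≠ t → ¬ (G i).Adj p z :=
    fun i hi p hp z hz hzs hzt => B.not_adj_of_isClosedSeq H hv hc hs' ht' hi hp hz hzs hzt
  have hdegA : ∀ i, i ∉ seg c 0 (2 * l) → ∀ x ∈ A, ∀ w, (G i).Adj x w → w ∈ insert t A' := by
    intro i hi x hx w hw
    have hwY := F.adj_left hw (hAX hx)
    by_contra hcon
    rw [Finset.mem_insert, memA' w hwY, not_or] at hcon
    exact hfree i hi x ((memA x (hAX hx)).1 hx) w hcon.2 (fun h => F.notMem_right hs (h ▸ hwY))
      hcon.1 hw
  obtain ⟨i₀, hi₀⟩ := F.exists_color (C := seg c 0 (2 * l)) (by simp [card_seg]; omega)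
  -- In an unused colour a cycle vertex sees only `l + 1` vertices, and below an outside vertex of
  -- `X` sees only `N + 1 - l`. With `N ≤ 2 * h` this gives `l = h`.
  have hlh : h ≤ l := by
    have := F.degree_le i₀ (v 0) (insert t A') (∅ : Finset V) id fun w hw =>
      Or.inl (hdegA i₀ hi₀ _ ((memA _ h0).2 (hmem 0)) w hw)
    rw [Finset.card_insert_of_notMem htA, hA'card] at this
    simpa using this
  have hNl : h + l ≤ N := by
    obtain ⟨z, hzX, hz⟩ : ∃ z ∈ X, z ∉ insert s A := by
      refine Finset.exists_mem_notMem_of_card_lt_card ?_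
      rw [Finset.card_insert_of_notMem hsA, hAcard, F.card_left]
      omega
    rw [Finset.mem_insert, memA z hzX, not_or] at hz
    have := F.degree_le i₀ z (Y \ A') (∅ : Finset V) id fun w hw => Or.inl ?_
    · rw [Finset.card_sdiff_of_subset hAY, hA'card, F.card_right] at this
      simp at this
      omega
    · have hwY := F.adj_left hw hzX
      rw [Finset.mem_sdiff, memA' w hwY]
      exact ⟨hwY, fun hwS => hfree i₀ hi₀ w hwS z hz.2 hz.1
        (fun h => F.notMem_right hzX (h ▸ ht)) hw.symm⟩
  obtain rfl : l = h := by omega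
  have hN : N = 2 * l := by omega
  have hcomplete : ∀ i, i ∉ seg c 0 (2 * l) → ∀ x ∈ A, ∀ y ∈ A', (G i).Adj x y := by
    intro i hi x hx y hy
    refine F.adj_of_subset (hdegA i hi x hx) ?_ (Finset.mem_insert_of_mem hy)
    rw [Finset.card_insert_of_notMem htA, hA'card]
  -- Besides `i` at least `2 * l` colours are unused by `c`, and each is complete between `A` and
  -- `A'`. They recolour the path round the cycle from `p`, so an edge `pz` of colour `i` would
  -- extend it.
  have hall : ∀ i, ∀ p ∈ seg v 0 (2 * l), ∀ z ∉ seg v 0 (2 * l), z ≠ s → z ≠ t →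
      ¬ (G i).Adj p z := by
    intro i p hp z hz hzs hzt
    obtain ⟨k, -, hk, rfl⟩ := mem_seg.1 hp
    have : Nonempty ι := ⟨i⟩
    obtain ⟨d, hd, hdn⟩ := exists_seq_nodup (T := (seg c 0 (2 * l)).toFinsetᶜ.erase i)
      (m := 2 * l - 1) <| by
        have h1 := Finset.pred_card_le_card_erase (s := (seg c 0 (2 * l)).toFinsetᶜ) (a := i)
        rw [Finset.card_compl, Multiset.toFinset_card_of_nodup hc, card_seg,
          F.card_colors] at h1
        omega
    have hd' : ∀ j < 2 * l - 1, d j ≠ i ∧ d j ∉ seg c 0 (2 * l) := by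
      intro j hj
      simpa using hd j hj
    have hw := ColoredWalk.of_seq (G := G) (fun n => v (n + k)) d (Nat.zero_le (2 * l - 1))
      fun j _ hj => by
        have hadj := H.adj (j + k)
        have m1 := hmem (j + k)
        have m2 := hmem (j + k + 1)
        rw [show j + 1 + k = j + k + 1 by omega]
        rcases F.cover (v (j + k)) with hx | hx
        · exact hcomplete _ (hd' j hj).2 _ ((memA _ hx).2 m1) _
            ((memA' _ (F.adj_left hadj hx)).2 m2)
        · exact (hcomplete _ (hd' j hj).2 _ ((memA _ (F.adj_right hadj hx)).2 m2) _
            ((memA' _ hx).2 m1)).symm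
    rw [show 2 * l - 1 + 1 = 2 * l by omega, seg_shift, zero_add, add_comm (2 * l) k,
      seg_periodic H.period_vert] at hw
    refine B.not_adj hw hv hdn hs' ht' (by simp [card_seg]) (fun h => ?_) hz hzs hzt
    obtain ⟨j, -, hj, hji⟩ := mem_seg.1 h
    exact (hd' j hj).1 hji
  have hX : IsSplit X s A (X \ insert s A) l := by
    refine ⟨?_, hsA, by simp, Finset.disjoint_sdiff.mono_left (Finset.subset_insert _ _), hAcard,
      ?_⟩
    · rw [← Finset.insert_eq, Finset.union_sdiff_of_subset (Finset.insert_subset hs hAX)]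
    · rw [Finset.card_sdiff_of_subset (Finset.insert_subset hs hAX),
        Finset.card_insert_of_notMem hsA, hAcard, F.card_left]
      omega
  have hY : IsSplit Y t A' (Y \ insert t A') l := by
    refine ⟨?_, htA, by simp, Finset.disjoint_sdiff.mono_left (Finset.subset_insert _ _), hA'card,
      ?_⟩
    · rw [← Finset.insert_eq, Finset.union_sdiff_of_subset (Finset.insert_subset ht hAY)]
    · rw [Finset.card_sdiff_of_subset (Finset.insert_subset ht hAY),
        Finset.card_insert_of_notMem htA, hA'card, F.card_right]
      omega
  refine ⟨_, _, _, _, hX, hY, hN, fun i => F.eq_graphF_or_eq_graphF' hX hY i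
    (fun x hx y hy => ?_) fun x hx y hy hxy => ?_⟩
  · rw [Finset.mem_sdiff, Finset.mem_insert, not_or, memA' y (by simp_all)] at hy
    exact hall i x ((memA x (hAX hx)).1 hx) y hy.2.2 (fun h => F.notMem_right hs (h ▸ hy.1)) hy.2.1
  · rw [Finset.mem_sdiff, Finset.mem_insert, not_or, memA x (by simp_all)] at hx
    exact hall i y ((memA' y (hAY hy)).1 hy) x hx.2.2 hx.2.1 (fun h => F.notMem_right hx.1 (h ▸ ht))
      hxy.symm

/-- Either the collection has a transversal Hamiltonian path between `s` and `t`, or every graph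
of the collection is one of the two extremal graphs. -/
theorem hasPath_or_exists_split [DecidableEq V] (F : IsDenseFamily G X Y N h) (hs : s ∈ X)
    (ht : t ∈ Y) : HasHamiltonianPathTransversal G s t ∨
    ∃ X₁ X₂ Y₁ Y₂ : Finset V, IsSplit X s X₁ X₂ h ∧ IsSplit Y t Y₁ Y₂ h ∧ N = 2 * h ∧
      ∀ i, G i = graphF s t X₁ X₂ Y₁ Y₂ ∨ G i = graphF' s t X₁ X₂ Y₁ Y₂ := by
  classical
  have hst : s ≠ t := fun h => F.notMem_right hs (h ▸ ht)
  have hbound : ∀ {a b : V} {S : Multiset V} {C : Multiset ι}, ColoredWalk G a b S C → S.Nodup →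
      s ∉ S → t ∉ S → S.card ≤ 2 * N := by
    intro a b S C _ hS hs' ht'
    have h1 := Finset.card_le_univ (s ::ₘ t ::ₘ S).toFinset
    rw [Multiset.toFinset_card_of_nodup (by simp [hst, hs', ht', hS]), F.card_verts] at h1
    simpa using h1
  let P : ℕ → Prop := fun k => ∃ (a b : V) (S : Multiset V) (C : Multiset ι),
    ColoredWalk G a b S C ∧ S.Nodup ∧ C.Nodup ∧ s ∉ S ∧ t ∉ S ∧ S.card = k
  have hP1 : P 1 := by
    obtain ⟨x, hx, hxs⟩ := X.exists_mem_ne (by rw [F.card_left]; have := F.pos; omega) s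
    exact ⟨x, x, {x}, 0, .single x, by simp, by simp, by simpa using hxs.symm,
      by simpa using fun h : t = x => F.notMem_right hx (h ▸ ht), by simp⟩
  have hpos := F.pos
  obtain ⟨a, b, S, C, hw, hS, hC, hs', ht', hK⟩ :=
    Nat.findGreatest_spec (P := P) (n := 2 * N) (by omega) hP1
  set K := Nat.findGreatest P (2 * N) with hKdef
  have hKpos : 1 ≤ K := Nat.le_findGreatest (by omega) hP1
  have B : PathsBounded G s t K := fun a b S C hw hS hC hs' ht' =>
    Nat.le_findGreatest (hbound hw hS hs' ht') ⟨a, b, S, C, hw, hS, hC, hs', ht', rfl⟩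
  have hKN : K ≤ 2 * N := hK ▸ hbound hw hS hs' ht'
  obtain ⟨l, hl | hl⟩ := Nat.even_or_odd' K
  · rw [hl] at B hK hKN hKpos
    rcases (show l ≤ N by omega).eq_or_lt with rfl | hlN
    · exact Or.inl (F.hasPath_of_card_eq hw hS hC hK hs ht hs' ht')
    · obtain ⟨v, c, H, h0, rfl, hc⟩ := F.exists_closed_of_even B hw hS hC hs' ht' hK hlN hs ht
      exact Or.inr (F.exists_split_of_closed B H h0 hS hc hs' ht' (by omega) hlN hs ht)
  · rw [hl] at B hK hKN
    exact (F.not_odd B hw hS hC hs' ht' hK (by omega) hs ht).elim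

end IsDenseFamily

end Extremal
end BipartiteTransversal

/-! ### The theorem -/

theorem theorem1p4 {V : Type*} [Fintype V] [DecidableEq V] (n : ℕ) (X Y : Finset V)
    (hdisj : Disjoint X Y) (hunion : X ∪ Y = Finset.univ)
    (hX : X.card = n) (hY : Y.card = n)
    (G : Fin (2 * n - 1) → SimpleGraph V) [∀ i, DecidableRel (G i).Adj]
    (hbip : ∀ i, (G i).IsBipartiteWith (X : Set V) (Y : Set V))
    (hdeg : ∀ i, ⌈((n : ℚ) + 1) / 2⌉₊ ≤ (G i).minDegree) :
    BipartiteTransversal.HamiltonianConnected X Y G ∨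
      (Odd n ∧ ∃ (x y : V) (X₁ X₂ Y₁ Y₂ : Finset V),
        BipartiteTransversal.IsSplit X x X₁ X₂ ((n - 1) / 2) ∧
        BipartiteTransversal.IsSplit Y y Y₁ Y₂ ((n - 1) / 2) ∧
        ∀ i, G i = BipartiteTransversal.graphF x y X₁ X₂ Y₁ Y₂ ∨
          G i = BipartiteTransversal.graphF' x y X₁ X₂ Y₁ Y₂) := by
  obtain ⟨N, rfl | rfl⟩ : ∃ N, n = 0 ∨ n = N + 1 := ⟨n - 1, by omega⟩
  · left
    rw [Finset.card_eq_zero] at hX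
    subst hX
    exact fun x hx => absurd hx (Finset.notMem_empty x)
  have adj_left : ∀ {i a b}, (G i).Adj a b → a ∈ X → b ∈ Y := by
    intro i a b hab ha
    rcases (hbip i).mem_of_adj hab with h | h
    · exact h.2
    · exact absurd h.1 (Finset.disjoint_left.1 hdisj ha)
  have adj_right : ∀ {i a b}, (G i).Adj a b → a ∈ Y → b ∈ X := by
    intro i a b hab ha
    rcases (hbip i).mem_of_adj hab with h | h
    · exact absurd ha (Finset.disjoint_left.1 hdisj h.1)
    · exact h.2
  have cover : ∀ z, z ∈ X ∨ z ∈ Y := fun z => by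
    rw [← Finset.mem_union, hunion]; exact Finset.mem_univ z
  have hceil : N + 2 ≤ 2 * ⌈(((N + 1 : ℕ) : ℚ) + 1) / 2⌉₊ := by
    have h1 := Nat.le_ceil ((((N + 1 : ℕ) : ℚ) + 1) / 2)
    have h2 : ((N + 2 : ℕ) : ℚ) ≤ ((2 * ⌈(((N + 1 : ℕ) : ℚ) + 1) / 2⌉₊ : ℕ) : ℚ) := by
      rw [Nat.cast_mul]
      push_cast at h1 ⊢
      linarith
    exact_mod_cast h2
  obtain ⟨h, hh⟩ : ∃ h, ⌈(((N + 1 : ℕ) : ℚ) + 1) / 2⌉₊ = h + 1 :=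
    Nat.exists_eq_succ_of_ne_zero (by omega)
  rw [hh] at hdeg hceil
  have degree : ∀ i v, h + 1 ≤ ((G i).neighborSet v).ncard := by
    intro i v
    refine ((hdeg i).trans ((G i).minDegree_le_degree v)).trans_eq ?_
    rw [← SimpleGraph.card_neighborSet_eq_degree, ← Nat.card_eq_fintype_card, Nat.card_coe_set_eq]
  -- For `n = 1` the single edge is the path; `IsDenseFamily` requires `1 ≤ N`.
  rcases Nat.eq_zero_or_pos N with rfl | hN
  · left
    intro x hx y hy
    obtain ⟨w, hw⟩ := Set.nonempty_of_ncard_ne_zero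
      (s := (G ⟨0, by omega⟩).neighborSet x) (by have := degree ⟨0, by omega⟩ x; omega)
    obtain rfl : w = y := Finset.card_le_one.1 hY.le w (adj_left hw hx) y hy
    refine (BipartiteTransversal.ColoredWalk.cons hw (.single w)).hasHamiltonianPathTransversal
      (by simpa using (show x ≠ w from hw.ne)) (by simp) (fun z => ?_) fun i => ?_
    · rcases cover z with hz | hz
      · simp [Finset.card_le_one.1 hX.le z hz x hx]
      · simp [Finset.card_le_one.1 hY.le z hz w hy]
    · have : i = ⟨0, by omega⟩ := Fin.ext (by have := i.2; simp only; omega)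
      simp [this]
  have F : BipartiteTransversal.IsDenseFamily G X Y N h :=
    ⟨hdisj, cover, hX, hY, adj_left, adj_right, degree, by omega, hN, by
      rw [Fintype.card_fin]; omega⟩
  by_cases hcon : BipartiteTransversal.HamiltonianConnected X Y G
  · exact Or.inl hcon
  · right
    simp only [BipartiteTransversal.HamiltonianConnected, not_forall] at hcon
    obtain ⟨s, hs, t, ht, hst⟩ := hcon
    obtain ⟨X₁, X₂, Y₁, Y₂, h1, h2, h3, h4⟩ := (F.hasPath_or_exists_split hs ht).resolve_left hst
    have h5 : (N + 1 - 1) / 2 = h := by omega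
    exact ⟨⟨h, by omega⟩, s, t, X₁, X₂, Y₁, Y₂, h5 ▸ h1, h5 ▸ h2, h4⟩
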